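/- Let $\Omega\subset\mathbb R^2$ be a bounded polygonal domain and $k\ge 0$ an integer. For a (conforming) triangulation $\mathcal T_h$ of $\Omega$ with set of edges $\mathcal E_h$, write $h_K$ for the diameter of $K\in\mathcal T_h$ and $h=\max_K h_K$. Call $\mathcal T_h$ quasi-uniform with constant $\delta>0$ if every $K\in\mathcal T_h$ contains a disc of radius $\delta h$. Fix a unit normal $\boldsymbol n_e$ on each edge $e\in\mathcal E_h$, let $\boldsymbol n$ denote the outward unit normal on $\partial K$, and let $\mathbb P_m(D)$ be the space of (restrictions to $D$ of) polynomials of degree at most $m$. Let $V_h$ be the space of all pairs $v=\{v_0,v_n\boldsymbol n_e\}$ where $v_0\in H_0^1(\Omega)$, $v_0|_K\in\mathbb P_{k+2}(K)$ for all $K\in\mathcal T_h$, and $v_n|_e\in\mathbb P_{k+1}(e)$ for all $e\in\mathcal E_h$. For $v\in V_h$ the weak Laplacian $\Delta_w v=\Delta_{w,k+3}v$ is, on each $K\in\mathcal T_h$, the unique polynomial $(\Delta_w v)|_K\in\mathbb P_{k+3}(K)$ with $$(\Delta_w v,\varphi)_K=-(\nabla v_0,\nabla\varphi)_K+\langle v_n\boldsymbol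 n_e\cdot\boldsymbol n,\varphi\rangle_{\partial K}\qquad\text{for all }\varphi\in\mathbb P_{k+3}(K),$$ where $(\cdot,\cdot)_K$ and $\langle\cdot,\cdot\rangle_{\partial K}$ are the $L^2(K)$ and $L^2(\partial K)$ inner products. Put $$|||v|||=\Big[\sum_{K\in\mathcal T_h}\|\Delta_w v\|_{L^2(K)}^2\Big]^{1/2},\qquad \|v\|_{2,h}=\Big[\sum_{K\in\mathcal T_h}\Big(\|\Delta v_0\|_{L^2(K)}^2+h_K^{-1}\Big\|\frac{\partial v_0}{\partial\boldsymbol n_e}-v_n\Big\|_{L^2(\partial K)}^2\Big)\Big]^{1/2},$$ where on $\partial K$ the derivative $\partial v_0/\partial\boldsymbol n_e=\nabla v_0\cdot\boldsymbol n_e$ is that of $v_0|_K$. Then for every $\delta>0$ there exist two positive constants $C_1$ and $C_2$, depending only on $\Omega$, $k$ and $\delta$ (in particular independent of $h$), such that for every triangulation $\mathcal T_h$ of $\Omega$ that is quasi-uniform with constant $\delta$, every choice of the unit normals $\boldsymbol n_e$, and every $v\in V_h$, $$C_1\|v\|_{2,h}\le|||v|||\le C_2\|v\|_{2,h}.$$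 -/

import Mathlib

open MeasureTheory
open scoped ContDiff Gradient RealInnerProductSpace

/-- The Euclidean plane `ℝ²`. -/
abbrev Plane : Type := EuclideanSpace ℝ (Fin 2)

/-! ### Polygonal domains and the Sobolev space `H₀¹(Ω)` -/

/-- A bounded polygonal domain: a nonempty bounded connected open set whose boundary is a finite
union of line segments. -/
structure IsPolygonalDomain (Ω : Set Plane) : Prop where
  isOpen : IsOpen Ω
  isConnected : IsConnected Ω
  isBounded : Bornology.IsBounded Ω
  frontier_eq : ∃ S : Finset (Plane × Plane), frontier Ω = ⋃ p ∈ S, segment ℝ p.1 p.2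

/-- Test functions `φ ∈ C_c^∞(Ω)`. -/
def IsTestFunction (Ω : Set Plane) (φ : Plane → ℝ) : Prop :=
  ContDiff ℝ ∞ φ ∧ HasCompactSupport φ ∧ tsupport φ ⊆ Ω

/-- `g` is the weak (distributional) gradient of `w` in `Ω`. -/
def HasWeakGradient (Ω : Set Plane) (w : Plane → ℝ) (g : Plane → Plane) : Prop :=
  ∀ φ, IsTestFunction Ω φ → ∀ i : Fin 2,
    ∫ x in Ω, w x * (∇ φ x) i = -∫ x in Ω, (g x) i * φ x

/-- `w ∈ H₀¹(Ω)`: `w` has a square integrable weak gradient and is a limit, in the `H¹(Ω)` norm,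
of test functions. -/
def MemH10 (Ω : Set Plane) (w : Plane → ℝ) : Prop :=
  MemLp w 2 (volume.restrict Ω) ∧
  ∃ g : Plane → Plane, MemLp g 2 (volume.restrict Ω) ∧ HasWeakGradient Ω w g ∧
    ∀ ε : ENNReal, 0 < ε → ∃ φ, IsTestFunction Ω φ ∧
      eLpNorm (fun x => w x - φ x) 2 (volume.restrict Ω) ≤ ε ∧
      eLpNorm (fun x => g x - ∇ φ x) 2 (volume.restrict Ω) ≤ ε

/-! ### Triangles, edges, polynomials -/

/-- The closed simplex (triangle or edge) spanned by a finite set of vertices. -/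
def hull (s : Finset Plane) : Set Plane := convexHull ℝ (s : Set Plane)

/-- The function on the plane given by a polynomial in two variables. -/
noncomputable def polyFun (p : MvPolynomial (Fin 2) ℝ) : Plane → ℝ :=
  fun x => MvPolynomial.eval (fun i => x i) p

/-- `f|_D ∈ ℙ_m(D)`. -/
def IsPolyOn (m : ℕ) (D : Set Plane) (f : Plane → ℝ) : Prop :=
  ∃ p : MvPolynomial (Fin 2) ℝ, p.totalDegree ≤ m ∧ Set.EqOn f (polyFun p) D

/-- The outward unit normal of the triangle with vertex set `K` on its edge `K.erase z` opposite to
the vertex `z ∈ K`: the component orthogonal to that edge of a vector which points from `z` into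
the triangle, normalized. -/
noncomputable def outwardNormal (K : Finset Plane) (z : Plane) : Plane :=
  let w := (vectorSpan ℝ ((K.erase z : Finset Plane) : Set Plane))ᗮ.starProjection
    (∑ a ∈ K, (a - z))
  ‖w‖⁻¹ • w

/-- `∫_{∂K} f ds` for the triangle with vertex set `K`. The integrand may depend on the edge: on
the edge `K.erase z` opposite to `z ∈ K` it is `f z`; `ds` is arc length. -/
noncomputable def boundaryIntegral (K : Finset Plane) (f : Plane → Plane → ℝ) : ℝ :=
  ∑ z ∈ K, ∫ x in hull (K.erase z), f z x ∂(Measure.hausdorffMeasure 1)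

/-! ### Triangulations -/

/-- A (conforming) triangulation of `Ω`: a finite pure two-dimensional simplicial complex which
covers `closure Ω` and whose open triangles lie in `Ω`. Faces are given by their vertex sets. -/
structure Triangulation (Ω : Set Plane) extends Geometry.SimplicialComplex ℝ Plane where
  finite_faces : faces.Finite
  pure : ∀ s ∈ faces, ∃ K ∈ faces, K.card = 3 ∧ s ⊆ K
  space_eq : toSimplicialComplex.space = closure Ω
  interior_subset : ∀ K ∈ faces, interior (hull K) ⊆ Ω

namespace Triangulation

variable {Ω : Set Plane}

/-- The elements (triangles) of the triangulation. -/
noncomputable def elements (T : Triangulation Ω) : Finset (Finset Plane) :=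
  T.finite_faces.toFinset.filter (fun s => s.card = 3)

/-- The edges of the triangulation. -/
noncomputable def edges (T : Triangulation Ω) : Finset (Finset Plane) :=
  T.finite_faces.toFinset.filter (fun s => s.card = 2)

/-- The mesh size `h = max_K h_K`, where `h_K` is the diameter of `K`. -/
noncomputable def meshSize (T : Triangulation Ω) : ℝ :=
  sSup ((fun K => Metric.diam (hull K)) '' (T.elements : Set (Finset Plane)))

/-- Quasi-uniformity with constant `δ`: every element contains a disc of radius `δ h`. -/
def IsQuasiUniform (T : Triangulation Ω) (δ : ℝ) : Prop :=
  ∀ K ∈ T.elements, ∃ c : Plane, Metric.closedBall c (δ * T.meshSize) ⊆ hull K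

/-- A choice `e ↦ n_e` of a unit normal on every edge. -/
def IsNormalChoice (T : Triangulation Ω) (ne : Finset Plane → Plane) : Prop :=
  ∀ e ∈ T.edges, ‖ne e‖ = 1 ∧ ∀ a ∈ e, ∀ b ∈ e, ⟪ne e, a - b⟫ = 0

/-- The weak Galerkin space `V_h`: pairs `v = (v₀, v_n)` with `v₀ ∈ H₀¹(Ω)`, `v₀|_K ∈ ℙ_{k+2}(K)`
for every element `K`, and `v_n|_e ∈ ℙ_{k+1}(e)` for every edge `e`. The piece of `v_n` on the edge
`e` is `v.2 e`; `v₀` is the representative which is a polynomial on every closed element. -/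
def WGSpace (T : Triangulation Ω) (k : ℕ) :
    Set ((Plane → ℝ) × (Finset Plane → Plane → ℝ)) :=
  {v | MemH10 Ω v.1 ∧ (∀ K ∈ T.elements, IsPolyOn (k + 2) (hull K) v.1) ∧
    ∀ e ∈ T.edges, IsPolyOn (k + 1) (hull e) (v.2 e)}

end Triangulation

/-! ### The weak Laplacian and the two norms -/

/-- The polynomial `ψ ∈ ℙ_m(K)` satisfies the equation which defines the weak Laplacian on `K`:
`(ψ, φ)_K = -(∇v₀, ∇φ)_K + ⟨v_n n_e ⬝ n, φ⟩_{∂K}` for all `φ ∈ ℙ_m(K)`. -/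
def IsWeakLaplacian (ne : Finset Plane → Plane) (m : ℕ)
    (v : (Plane → ℝ) × (Finset Plane → Plane → ℝ)) (K : Finset Plane)
    (ψ : MvPolynomial (Fin 2) ℝ) : Prop :=
  ψ.totalDegree ≤ m ∧ ∀ φ : MvPolynomial (Fin 2) ℝ, φ.totalDegree ≤ m →
    ∫ x in hull K, polyFun ψ x * polyFun φ x =
      -(∫ x in hull K, ⟪gradientWithin v.1 (hull K) x, ∇ (polyFun φ) x⟫) +
        boundaryIntegral K (fun z x =>
          v.2 (K.erase z) x * ⟪ne (K.erase z), outwardNormal K z⟫ * polyFun φ x)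

/-- The weak Laplacian `(Δ_{w,m} v)|_K`, the unique solution of its defining equation
(see `existsUnique_isWeakLaplacian`). -/
noncomputable def weakLaplacian (ne : Finset Plane → Plane) (m : ℕ)
    (v : (Plane → ℝ) × (Finset Plane → Plane → ℝ)) (K : Finset Plane) :
    MvPolynomial (Fin 2) ℝ :=
  Classical.epsilon (IsWeakLaplacian ne m v K)

/-- `|||v||| = (∑_K ‖Δ_{w,k+3} v‖²_{L²(K)})^{1/2}`. -/
noncomputable def tripleNorm {Ω : Set Plane} (T : Triangulation Ω) (ne : Finset Plane → Plane)
    (k : ℕ) (v : (Plane → ℝ) × (Finset Plane → Plane → ℝ)) : ℝ :=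
  Real.sqrt (∑ K ∈ T.elements, ∫ x in hull K, (polyFun (weakLaplacian ne (k + 3) v K) x) ^ 2)

/-- `‖v‖_{2,h} = (∑_K (‖Δv₀‖²_{L²(K)} + h_K⁻¹ ‖∂v₀/∂n_e - v_n‖²_{L²(∂K)}))^{1/2}`. The derivatives
of `v₀` on `K` are those of its restriction to the closed triangle `K`. -/
noncomputable def norm2h {Ω : Set Plane} (T : Triangulation Ω) (ne : Finset Plane → Plane)
    (v : (Plane → ℝ) × (Finset Plane → Plane → ℝ)) : ℝ :=
  Real.sqrt (∑ K ∈ T.elements,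
    ((∫ x in hull K, (InnerProductSpace.laplacianWithin v.1 (hull K) x) ^ 2) +
      (Metric.diam (hull K))⁻¹ * boundaryIntegral K (fun z x =>
        (⟪gradientWithin v.1 (hull K) x, ne (K.erase z)⟫ - v.2 (K.erase z) x) ^ 2)))


/-! ### Well-definedness -/

theorem contDiff_polyFun (p : MvPolynomial (Fin 2) ℝ) : ContDiff ℝ ∞ (polyFun p) := by
  unfold polyFun
  induction p using MvPolynomial.induction_on with
  | C a => simpa using contDiff_const
  | add p q hp hq => simpa using hp.add hq
  | mul_X p i hp =>
    simp only [map_mul, MvPolynomial.eval_X]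
    exact hp.mul (by fun_prop)

theorem continuous_gradient_polyFun (p : MvPolynomial (Fin 2) ℝ) :
    Continuous (∇ (polyFun p)) := by
  unfold gradient
  exact (InnerProductSpace.toDual ℝ Plane).symm.continuous.comp
    ((contDiff_polyFun p).continuous_fderiv (by simp))

theorem gradient_polyFun_add (p q : MvPolynomial (Fin 2) ℝ) (x : Plane) :
    ∇ (polyFun (p + q)) x = ∇ (polyFun p) x + ∇ (polyFun q) x := by
  have hp := ((contDiff_polyFun p).differentiable (by simp)) x
  have hq := ((contDiff_polyFun q).differentiable (by simp)) x
  have h : polyFun (p + q) = polyFun p + polyFun q := by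
    ext y; simp [polyFun]
  simp only [gradient, h, fderiv_add hp hq, map_add]

theorem gradient_polyFun_smul (c : ℝ) (p : MvPolynomial (Fin 2) ℝ) (x : Plane) :
    ∇ (polyFun (c • p)) x = c • ∇ (polyFun p) x := by
  have hp := ((contDiff_polyFun p).differentiable (by simp)) x
  have h : polyFun (c • p) = c • polyFun p := by
    ext y; simp [polyFun]
  simp only [gradient, h, fderiv_const_smul hp c]
  simp

theorem isCompact_hull (s : Finset Plane) : IsCompact (hull s) :=
  (Finset.finite_toSet s).isCompact_convexHull ℝ

/-- A nondegenerate triangle has interior points. -/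
theorem interior_hull_nonempty {K : Finset Plane}
    (hK : AffineIndependent ℝ ((↑) : K → Plane)) (hc : K.card = 3) :
    (interior (hull K)).Nonempty := by
  unfold hull
  rw [interior_convexHull_nonempty_iff_affineSpan_eq_top]
  have := (hK.affineSpan_eq_top_iff_card_eq_finrank_add_one).2 (by simp [hc])
  simpa using this

theorem gradientWithin_eq_of_eqOn {K : Finset Plane} (hi : (interior (hull K)).Nonempty)
    {f : Plane → ℝ} {p : MvPolynomial (Fin 2) ℝ} (hf : Set.EqOn f (polyFun p) (hull K)) :
    Set.EqOn (gradientWithin f (hull K)) (∇ (polyFun p)) (hull K) := by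
  intro x hx
  have hu : UniqueDiffOn ℝ (hull K) := uniqueDiffOn_convex (convex_convexHull ℝ _) hi
  simp only [gradientWithin, gradient]
  rw [fderivWithin_congr hf (hf hx), fderivWithin_eq_fderiv (hu x hx)
    (((contDiff_polyFun p).differentiable (by simp)) x)]

/-- A polynomial whose square has integral zero over a triangle is zero. -/
theorem eq_zero_of_integral_sq {K : Finset Plane} (hi : (interior (hull K)).Nonempty)
    {p : MvPolynomial (Fin 2) ℝ} (h : ∫ x in hull K, polyFun p x * polyFun p x = 0) : p = 0 := by
  have hcont := (contDiff_polyFun p).continuous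
  have hint : IntegrableOn (fun x => polyFun p x * polyFun p x) (hull K) :=
    (hcont.mul hcont).continuousOn.integrableOn_compact (isCompact_hull K)
  rw [integral_eq_zero_iff_of_nonneg (fun x => mul_self_nonneg _) hint] at h
  have h2 : (fun x => polyFun p x * polyFun p x) =ᵐ[volume.restrict (interior (hull K))]
      fun _ => 0 := ae_restrict_of_ae_restrict_of_subset interior_subset h
  have h3 := Measure.eqOn_open_of_ae_eq h2 isOpen_interior (hcont.mul hcont).continuousOn
    continuousOn_const
  obtain ⟨x, hx⟩ := hi
  have hopen : IsOpen ((WithLp.toLp 2 : (Fin 2 → ℝ) → Plane) ⁻¹' interior (hull K)) :=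
    isOpen_interior.preimage (PiLp.continuous_toLp 2 _)
  obtain ⟨r, hr, hb⟩ := Metric.isOpen_iff.1 hopen x.ofLp (by simpa using hx)
  apply MvPolynomial.funext_set (fun i : Fin 2 => Metric.ball (x i) r)
  · intro i
    rw [Real.ball_eq_Ioo]
    exact Set.Ioo_infinite (by linarith)
  · intro y hy
    have hy' : y ∈ Metric.ball x.ofLp r := by
      rw [ball_pi _ hr]; exact hy
    have := h3 (hb hy')
    simpa [polyFun] using this

/-- The weak Laplacian is well defined on every nondegenerate triangle. -/
theorem existsUnique_isWeakLaplacian (ne : Finset Plane → Plane) (m : ℕ)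
    (v : (Plane → ℝ) × (Finset Plane → Plane → ℝ)) {K : Finset Plane}
    (hK : AffineIndependent ℝ ((↑) : K → Plane)) (hc : K.card = 3)
    {j l : ℕ} (h0 : IsPolyOn j (hull K) v.1)
    (hn : ∀ z ∈ K, IsPolyOn l (hull (K.erase z)) (v.2 (K.erase z))) :
    ∃! ψ, IsWeakLaplacian ne m v K ψ := by
  have hi := interior_hull_nonempty hK hc
  obtain ⟨p, -, hp⟩ := h0
  have hg := gradientWithin_eq_of_eqOn hi hp
  have hc1 : ∀ a b : MvPolynomial (Fin 2) ℝ,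
      IntegrableOn (fun x => polyFun a x * polyFun b x) (hull K) := fun a b =>
    ((contDiff_polyFun a).continuous.mul (contDiff_polyFun b).continuous).continuousOn
      |>.integrableOn_compact (isCompact_hull K)
  have hc2 : ∀ a : MvPolynomial (Fin 2) ℝ,
      IntegrableOn (fun x => ⟪gradientWithin v.1 (hull K) x, ∇ (polyFun a) x⟫) (hull K) := by
    intro a
    refine ContinuousOn.integrableOn_compact (isCompact_hull K) ?_
    refine ContinuousOn.inner ?_ (continuous_gradient_polyFun a).continuousOn
    exact (continuous_gradient_polyFun p).continuousOn.congr hg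
  have hc3 : ∀ z ∈ K, ∀ a : MvPolynomial (Fin 2) ℝ,
      IntegrableOn (fun x => v.2 (K.erase z) x * ⟪ne (K.erase z), outwardNormal K z⟫ *
        polyFun a x) (hull (K.erase z)) (Measure.hausdorffMeasure 1) := by
    intro z hz a
    obtain ⟨q, -, hq⟩ := hn z hz
    have hcard : (K.erase z).card = 2 := by rw [Finset.card_erase_of_mem hz, hc]
    obtain ⟨y₁, y₂, -, hy⟩ := Finset.card_eq_two.1 hcard
    have hfin : Measure.hausdorffMeasure 1 (hull (K.erase z)) ≠ ⊤ := by
      rw [hy]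
      simp [hull, convexHull_pair, edist_ne_top]
    have hfm : IsFiniteMeasure
        ((Measure.hausdorffMeasure 1 : Measure Plane).restrict (hull (K.erase z))) :=
      ⟨by simpa [lt_top_iff_ne_top] using hfin⟩
    have hcn : ContinuousOn (fun x => v.2 (K.erase z) x *
        ⟪ne (K.erase z), outwardNormal K z⟫ * polyFun a x) (hull (K.erase z)) :=
      (((contDiff_polyFun q).continuous.continuousOn.congr hq).mul continuousOn_const).mul
        (contDiff_polyFun a).continuous.continuousOn
    have hcpt := isCompact_hull (K.erase z)
    obtain ⟨M, hM⟩ := hcpt.exists_bound_of_continuousOn hcn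
    refine Integrable.of_bound (hcn.aestronglyMeasurable_of_isCompact hcpt
      hcpt.measurableSet) M ?_
    exact (ae_restrict_iff' hcpt.measurableSet).2 (Filter.Eventually.of_forall hM)
  let V := MvPolynomial.restrictTotalDegree (Fin 2) ℝ m
  have add_eval : ∀ (a b : MvPolynomial (Fin 2) ℝ) x,
      polyFun (a + b) x = polyFun a x + polyFun b x := fun a b x => by simp [polyFun]
  have smul_eval : ∀ (c : ℝ) (a : MvPolynomial (Fin 2) ℝ) x,
      polyFun (c • a) x = c * polyFun a x := fun a b x => by simp [polyFun]
  let B : V →ₗ[ℝ] V →ₗ[ℝ] ℝ := LinearMap.mk₂ ℝ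
    (fun a b => ∫ x in hull K, polyFun a.1 x * polyFun b.1 x)
    (fun a b c => by
      simp only [Submodule.coe_add, add_eval, add_mul]
      exact integral_add (hc1 _ _) (hc1 _ _))
    (fun c a b => by
      simp only [Submodule.coe_smul, smul_eval, mul_assoc, integral_const_mul, smul_eq_mul])
    (fun a b c => by
      simp only [Submodule.coe_add, add_eval, mul_add]
      exact integral_add (hc1 _ _) (hc1 _ _))
    (fun c a b => by
      simp only [Submodule.coe_smul, smul_eval, mul_left_comm _ c, integral_const_mul,
        smul_eq_mul])
  let L : V →ₗ[ℝ] ℝ :=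
    { toFun := fun a => -(∫ x in hull K, ⟪gradientWithin v.1 (hull K) x, ∇ (polyFun a.1) x⟫) +
        boundaryIntegral K (fun z x =>
          v.2 (K.erase z) x * ⟪ne (K.erase z), outwardNormal K z⟫ * polyFun a.1 x)
      map_add' := fun a b => by
        simp only [Submodule.coe_add, add_eval, gradient_polyFun_add, inner_add_right, mul_add,
          boundaryIntegral]
        rw [integral_add (hc2 _) (hc2 _), Finset.sum_congr rfl (fun z hz =>
          integral_add (hc3 z hz a.1) (hc3 z hz b.1)), Finset.sum_add_distrib]
        ring
      map_smul' := fun c a => by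
        simp only [Submodule.coe_smul, smul_eval, gradient_polyFun_smul, inner_smul_right,
          boundaryIntegral, mul_left_comm _ c, integral_const_mul, ← Finset.mul_sum,
          smul_eq_mul, RingHom.id_apply]
        ring }
  have hinj : Function.Injective B := by
    rw [injective_iff_map_eq_zero]
    intro a ha
    have : B a a = 0 := by rw [ha]; rfl
    exact Subtype.ext (eq_zero_of_integral_sq hi this)
  have hsurj : Function.Surjective B :=
    (LinearMap.injective_iff_surjective_of_finrank_eq_finrank
      (Subspace.dual_finrank_eq (K := ℝ) (V := V)).symm).1 hinj
  obtain ⟨a, ha⟩ := hsurj L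
  have mem : ∀ φ : MvPolynomial (Fin 2) ℝ, φ.totalDegree ≤ m → φ ∈ V := fun φ h =>
    (MvPolynomial.mem_restrictTotalDegree (Fin 2) m φ).2 h
  refine ⟨a.1, ⟨(MvPolynomial.mem_restrictTotalDegree (Fin 2) m a.1).1 a.2, fun φ hφ => ?_⟩, ?_⟩
  · exact LinearMap.congr_fun ha ⟨φ, mem φ hφ⟩
  · rintro b ⟨hb, hb'⟩
    have : B ⟨b, mem b hb⟩ = B a := by
      rw [ha]
      ext φ
      exact hb' φ.1 ((MvPolynomial.mem_restrictTotalDegree (Fin 2) m φ.1).1 φ.2)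
    exact congrArg Subtype.val (hinj this)

/-- The vector `outwardNormal K z` is the outward unit normal on the edge opposite to `z`. -/
theorem outwardNormal_spec {K : Finset Plane} (hK : AffineIndependent ℝ ((↑) : K → Plane))
    (hc : K.card = 3) {z : Plane} (hz : z ∈ K) :
    ‖outwardNormal K z‖ = 1 ∧
      (∀ a ∈ K.erase z, ∀ b ∈ K.erase z, ⟪outwardNormal K z, a - b⟫ = 0) ∧
      ∀ a ∈ K.erase z, 0 < ⟪outwardNormal K z, a - z⟫ := by
  have hcard : (K.erase z).card = 2 := by rw [Finset.card_erase_of_mem hz, hc]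
  obtain ⟨y₁, y₂, hne, hy⟩ := Finset.card_eq_two.1 hcard
  set W := vectorSpan ℝ ((K.erase z : Finset Plane) : Set Plane) with hW
  set u := ∑ a ∈ K, (a - z) with hu
  set w := Wᗮ.starProjection u with hw
  have hWmem : ∀ a ∈ K.erase z, ∀ b ∈ K.erase z, a - b ∈ W := fun a ha b hb =>
    vsub_mem_vectorSpan ℝ (Finset.mem_coe.2 ha) (Finset.mem_coe.2 hb)
  have hw_mem : w ∈ Wᗮ := Submodule.starProjection_apply_mem _ _
  have horth : ∀ x ∈ W, ⟪w, x⟫ = 0 := fun x hx => by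
    rw [real_inner_comm]; exact hw_mem x hx
  have hsum : u = (y₁ - z) + (y₂ - z) := by
    rw [hu, ← Finset.add_sum_erase _ _ hz, hy, Finset.sum_pair hne]; simp
  have hwu : ⟪w, u⟫ = ‖w‖ ^ 2 := by
    have h := Submodule.sub_starProjection_mem_orthogonal (K := Wᗮ) u
    have h1 : ⟪w, u - w⟫ = 0 := h w hw_mem
    rw [inner_sub_right, real_inner_self_eq_norm_sq] at h1
    linarith
  have h1 : y₁ ∈ K.erase z := by rw [hy]; simp
  have h2 : y₂ ∈ K.erase z := by rw [hy]; simp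
  have hne0 : w ≠ 0 := by
    intro h0
    have huW : u ∈ W := by
      have := Submodule.sub_starProjection_mem_orthogonal (K := Wᗮ) u
      rw [← hw, h0, sub_zero, Submodule.orthogonal_orthogonal] at this
      exact this
    have h12 : (2 : ℝ) • (z - y₁) ∈ W := by
      have := W.sub_mem (hWmem y₂ h2 y₁ h1) huW
      rw [hsum] at this
      convert this using 1
      module
    have hzW : z - y₁ ∈ W := (W.smul_mem_iff (by norm_num)).1 h12
    have hzs : z ∈ affineSpan ℝ ((K.erase z : Finset Plane) : Set Plane) := by
      have := AffineSubspace.vadd_mem_of_mem_direction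
        (s := affineSpan ℝ ((K.erase z : Finset Plane) : Set Plane))
        (by rw [direction_affineSpan]; exact hzW)
        (subset_affineSpan ℝ _ (Finset.mem_coe.2 h1))
      simpa using this
    have := hK.notMem_affineSpan_sdiff ⟨z, hz⟩ Set.univ
    apply this
    convert hzs using 2
    ext x
    simp only [Set.mem_image, Set.mem_sdiff, Set.mem_univ, true_and, Set.mem_singleton_iff,
      Finset.coe_erase]
    constructor
    · rintro ⟨⟨y, hy⟩, hyz, rfl⟩
      exact ⟨hy, fun h => hyz (Subtype.ext h)⟩
    · rintro ⟨hx, hxz⟩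
      exact ⟨⟨x, hx⟩, fun h => hxz (congrArg Subtype.val h), rfl⟩
  have hpos : 0 < ‖w‖ := norm_pos_iff.2 hne0
  have hdef : outwardNormal K z = ‖w‖⁻¹ • w := rfl
  refine ⟨?_, ?_, ?_⟩
  · rw [hdef, norm_smul, norm_inv, norm_norm, inv_mul_cancel₀ hpos.ne']
  · intro a ha b hb
    rw [hdef, real_inner_smul_left, horth _ (hWmem a ha b hb), mul_zero]
  · intro a ha
    rw [hdef, real_inner_smul_left]
    refine mul_pos (inv_pos.2 hpos) ?_
    have e : (2 : ℝ) * ⟪w, a - z⟫ = ‖w‖ ^ 2 := by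
      have e1 := horth _ (hWmem a ha y₁ h1)
      have e2 := horth _ (hWmem a ha y₂ h2)
      rw [← hwu, hsum]
      simp only [inner_sub_right, inner_add_right] at e1 e2 ⊢
      linarith
    nlinarith [pow_pos hpos 2]

/-! ### Calculus of polynomial functions on the plane -/

/-! The whole estimate is local. On a triangle `K`, Green's formula turns the equation defining `ψ =
Δ_w v` into `(ψ, φ)_K = (G, φ)_K + ∑_e ⟨g_e, φ⟩_e` for all `φ` of degree at most `k + 3`, where `G =
Δv₀` and `g_e = ±(v_n - ∂v₀/∂n_e)` with sign `n_e ⬝ n` (`green_triangle`, `exists_element_bounds`).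
It remains to show that `‖ψ‖²_K` is comparable to `‖G‖²_K + h_K⁻¹ ∑_e ‖g_e‖²_e` with a constant
depending only on `k` and `δ` (`exists_local_bounds`); summing over the elements and taking square
roots gives the theorem.

The upper bound comes from testing with `φ = ψ`, Young's inequality and the discrete trace
inequality `h_K ‖ψ‖²_e ≲ ‖ψ‖²_K` (`exists_trace_bound`, `edge_term_le`).

The lower bound uses bubble functions. With the cubic bubble `b`, the choice `φ = b G` removes all
boundary terms and yields `‖G‖ ≲ ‖ψ‖` (`exists_bubble_bound`). For an edge, `φ` is the product of
the two barycentric coordinates of its endpoints and an extension of `g_e`. It vanishes on the other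
two edges, so `h_K⁻¹ ‖g_e‖²_e` is controlled by `‖ψ - G‖²_K` (`exists_edge_bound`). The degree `k +
3` is exactly what both tests need: `3 + k` for `b G` and `2 + (k + 1)` for the edge function.

Each polynomial inequality is proved once on a reference triangle or interval, where it is a
comparison of quadratic forms on a finite-dimensional space (`exists_integral_sq_le`), and is then
transported by an affine map. The shape of `K` enters only through `2 δ h_K |e| ≤ |J| ≤ h_K |e|`,
where `|J|` is twice the area: the inscribed disc gives the left inequality, the diameter the right
one. -/

@[simp] theorem polyFun_add (p q : MvPolynomial (Fin 2) ℝ) (x : Plane) :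
    polyFun (p + q) x = polyFun p x + polyFun q x := by simp [polyFun]

@[simp] theorem polyFun_sub (p q : MvPolynomial (Fin 2) ℝ) (x : Plane) :
    polyFun (p - q) x = polyFun p x - polyFun q x := by simp [polyFun]

@[simp] theorem polyFun_mul (p q : MvPolynomial (Fin 2) ℝ) (x : Plane) :
    polyFun (p * q) x = polyFun p x * polyFun q x := by simp [polyFun]

@[simp] theorem polyFun_C (c : ℝ) (x : Plane) : polyFun (MvPolynomial.C c) x = c := by
  simp [polyFun]

@[simp] theorem polyFun_zero (x : Plane) : polyFun 0 x = 0 := by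
  simp [polyFun]

@[simp] theorem polyFun_one (x : Plane) : polyFun 1 x = 1 := by
  simp [polyFun]

@[simp] theorem polyFun_X (i : Fin 2) (x : Plane) : polyFun (MvPolynomial.X i) x = x i := by
  simp [polyFun]

@[simp] theorem polyFun_aeval (P : Polynomial ℝ) (p : MvPolynomial (Fin 2) ℝ) (x : Plane) :
    polyFun (Polynomial.aeval p P) x = P.eval (polyFun p x) := by
  have h := Polynomial.map_aeval_eq_aeval_map (R := ℝ) (S := MvPolynomial (Fin 2) ℝ) (T := ℝ)
    (U := ℝ) (φ := RingHom.id ℝ) (ψ := MvPolynomial.eval (fun i => x i))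
    (by ext; simp) P p
  simpa [polyFun] using h

theorem continuous_polyFun (p : MvPolynomial (Fin 2) ℝ) : Continuous (polyFun p) :=
  (contDiff_polyFun p).continuous

theorem integrableOn_polyFun_hull (p : MvPolynomial (Fin 2) ℝ) (K : Finset Plane) :
    IntegrableOn (polyFun p) (hull K) :=
  (continuous_polyFun p).continuousOn.integrableOn_compact (isCompact_hull K)

theorem hasFDerivAt_polyFun (p : MvPolynomial (Fin 2) ℝ) (x : Plane) :
    HasFDerivAt (polyFun p)
      (∑ i, polyFun (MvPolynomial.pderiv i p) x • (EuclideanSpace.proj i : Plane →L[ℝ] ℝ)) x := by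
  induction p using MvPolynomial.induction_on with
  | C a =>
    have : polyFun (MvPolynomial.C a) = fun _ => a := by ext; simp
    rw [this]
    refine (hasFDerivAt_const a x).congr_fderiv ?_
    ext; simp [polyFun]
  | add p q hp hq =>
    have : polyFun (p + q) = polyFun p + polyFun q := by ext; simp
    rw [this]
    refine (hp.add hq).congr_fderiv ?_
    simp only [map_add, polyFun_add, add_smul, Finset.sum_add_distrib]
  | mul_X p i hp =>
    have : polyFun (p * MvPolynomial.X i) = fun y => polyFun p y * y i := by ext; simp
    rw [this]
    have hX : HasFDerivAt (fun y : Plane => y i) (EuclideanSpace.proj i : Plane →L[ℝ] ℝ) x :=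
      (EuclideanSpace.proj i : Plane →L[ℝ] ℝ).hasFDerivAt
    refine (hp.mul hX).congr_fderiv ?_
    ext y
    fin_cases i <;> simp [Fin.sum_univ_two, MvPolynomial.pderiv_X] <;> ring

theorem fderiv_polyFun_apply (p : MvPolynomial (Fin 2) ℝ) (x v : Plane) :
    fderiv ℝ (polyFun p) x v = ∑ i, polyFun (MvPolynomial.pderiv i p) x * v i := by
  rw [(hasFDerivAt_polyFun p x).fderiv]
  simp

theorem inner_gradient_polyFun (p : MvPolynomial (Fin 2) ℝ) (x v : Plane) :
    ⟪∇ (polyFun p) x, v⟫ = ∑ i, polyFun (MvPolynomial.pderiv i p) x * v i := by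
  rw [← fderiv_polyFun_apply, gradient, InnerProductSpace.toDual_symm_apply]

theorem gradient_polyFun_apply (p : MvPolynomial (Fin 2) ℝ) (x : Plane) (i : Fin 2) :
    (∇ (polyFun p) x) i = polyFun (MvPolynomial.pderiv i p) x := by
  have h := inner_gradient_polyFun p x (EuclideanSpace.single i 1)
  rw [EuclideanSpace.inner_single_right] at h
  fin_cases i <;> simpa using h

/-- The Laplacian of a polynomial. -/
noncomputable def polyLaplacian (p : MvPolynomial (Fin 2) ℝ) : MvPolynomial (Fin 2) ℝ :=
  ∑ i, MvPolynomial.pderiv i (MvPolynomial.pderiv i p)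

/-- A convex set with interior points has unique derivatives even at its boundary, so the
derivatives within the closed triangle are those of the polynomial. -/
theorem laplacianWithin_eq_of_eqOn {K : Finset Plane} (hi : (interior (hull K)).Nonempty)
    {f : Plane → ℝ} {p : MvPolynomial (Fin 2) ℝ} (hf : Set.EqOn f (polyFun p) (hull K)) :
    Set.EqOn (InnerProductSpace.laplacianWithin f (hull K)) (polyFun (polyLaplacian p))
      (hull K) := by
  intro x hx
  have hu : UniqueDiffOn ℝ (hull K) := uniqueDiffOn_convex (convex_convexHull ℝ _) hi
  rw [InnerProductSpace.laplacianWithin_eq_iteratedFDerivWithin_orthonormalBasis f hu hx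
    (EuclideanSpace.basisFun (Fin 2) ℝ), iteratedFDerivWithin_congr hf hx,
    iteratedFDerivWithin_eq_iteratedFDeriv hu ((contDiff_infty.1
      (contDiff_polyFun p) 2).contDiffAt) hx]
  have hd : DifferentiableAt ℝ (fderiv ℝ (polyFun p)) x :=
    ((contDiff_infty.1 (contDiff_polyFun p) 2).fderiv_right (m := 1) (by norm_num)).differentiable
      (by simp) x
  have key : ∀ v w : Plane, iteratedFDeriv ℝ 2 (polyFun p) x ![v, w] =
      ∑ i, (∑ j, polyFun (MvPolynomial.pderiv j (MvPolynomial.pderiv i p)) x * v j) * w i := by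
    intro v w
    rw [iteratedFDeriv_two_apply]
    have h1 : HasFDerivAt (fun y => fderiv ℝ (polyFun p) y w)
        ((ContinuousLinearMap.apply ℝ ℝ w).comp (fderiv ℝ (fderiv ℝ (polyFun p)) x)) x :=
      (ContinuousLinearMap.apply ℝ ℝ w).hasFDerivAt.comp x hd.hasFDerivAt
    have h2 : HasFDerivAt (fun y => fderiv ℝ (polyFun p) y w)
        (∑ i, w i • ∑ j, polyFun (MvPolynomial.pderiv j (MvPolynomial.pderiv i p)) x •
          (EuclideanSpace.proj j : Plane →L[ℝ] ℝ)) x := by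
      simp only [fderiv_polyFun_apply]
      exact HasFDerivAt.fun_sum fun i _ => (hasFDerivAt_polyFun _ x).mul_const (w i)
    -- The derivative of `y ↦ D p(y) w` is computed once abstractly and once from partial
    -- derivatives; uniqueness identifies the second derivative.
    have h3 := congrArg (fun L : Plane →L[ℝ] ℝ => L v) (h1.unique h2)
    simp only [ContinuousLinearMap.comp_apply, ContinuousLinearMap.apply_apply] at h3
    simp only [Matrix.cons_val_zero, Matrix.cons_val_one]
    rw [h3]
    simp
    ring
  simp only [key, polyLaplacian]
  simp

theorem totalDegree_pderiv_le {p : MvPolynomial (Fin 2) ℝ} {m : ℕ} (hp : p.totalDegree ≤ m + 1)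
    (i : Fin 2) : (MvPolynomial.pderiv i p).totalDegree ≤ m := by
  conv_lhs => rw [p.as_sum, map_sum]
  refine MvPolynomial.totalDegree_finsetSum_le fun d hd => ?_
  rw [MvPolynomial.pderiv_monomial]
  -- If the exponent is zero, the truncated subtraction does not lower the degree, but then the
  -- coefficient `d i` annihilates the monomial.
  by_cases h0 : d i = 0
  · simp [h0]
  refine (MvPolynomial.totalDegree_monomial_le _ _).trans ?_
  have h1 := (MvPolynomial.le_totalDegree hd).trans hp
  have h2 : (d - Finsupp.single i 1) + Finsupp.single i 1 = d := by
    refine tsub_add_cancel_of_le ?_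
    rw [Finsupp.single_le_iff]; omega
  rw [← h2, Finsupp.sum_add_index' (by simp) (by simp)] at h1
  simp only [Finsupp.sum_single_index] at h1
  exact Nat.le_of_lt_succ h1

theorem totalDegree_polyLaplacian_le {p : MvPolynomial (Fin 2) ℝ} {m : ℕ}
    (hp : p.totalDegree ≤ m + 2) : (polyLaplacian p).totalDegree ≤ m :=
  MvPolynomial.totalDegree_finsetSum_le fun _ _ =>
    totalDegree_pderiv_le (totalDegree_pderiv_le hp _) _

theorem totalDegree_aeval_le {σ : Type*} {p : MvPolynomial (Fin 2) ℝ} {m : ℕ}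
    (hp : p.totalDegree ≤ m) {f : Fin 2 → MvPolynomial σ ℝ} (hf : ∀ i, (f i).totalDegree ≤ 1) :
    (MvPolynomial.aeval f p).totalDegree ≤ m := by
  rw [MvPolynomial.aeval_def, MvPolynomial.eval₂_eq]
  refine MvPolynomial.totalDegree_finsetSum_le fun d hd => ?_
  refine (MvPolynomial.totalDegree_mul _ _).trans ?_
  have h1 := (MvPolynomial.le_totalDegree hd).trans hp
  have h2 : (∏ i ∈ d.support, f i ^ d i).totalDegree ≤ ∑ i ∈ d.support, d i := by
    refine (MvPolynomial.totalDegree_finsetProd _ _).trans (Finset.sum_le_sum fun i _ => ?_)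
    exact (MvPolynomial.totalDegree_pow _ _).trans (by nlinarith [hf i])
  have h3 : d.sum (fun _ e => e) = ∑ i ∈ d.support, d i := rfl
  have h4 : (algebraMap ℝ (MvPolynomial σ ℝ) (p.coeff d)).totalDegree = 0 :=
    MvPolynomial.totalDegree_C _
  omega

theorem totalDegree_polynomial_aeval_le {P : Polynomial ℝ} {m : ℕ} (hP : P.natDegree ≤ m)
    {f : MvPolynomial (Fin 2) ℝ} (hf : f.totalDegree ≤ 1) :
    (Polynomial.aeval f P).totalDegree ≤ m := by
  rw [Polynomial.aeval_eq_sum_range]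
  refine MvPolynomial.totalDegree_finsetSum_le fun d hd => ?_
  refine (MvPolynomial.totalDegree_smul_le _ _).trans ?_
  refine (MvPolynomial.totalDegree_pow _ _).trans ?_
  have := Finset.mem_range.1 hd
  nlinarith

/-! ### Affine parametrization of triangles and segments -/

/-- The reference triangle. -/
def refTriangle : Set (ℝ × ℝ) := {p | 0 ≤ p.1 ∧ 0 ≤ p.2 ∧ p.1 + p.2 ≤ 1}

/-- The affine map which sends `(0, 0)`, `(1, 0)`, `(0, 1)` to `a`, `b`, `c`. -/
noncomputable def affPt (a b c : Plane) (p : ℝ × ℝ) : Plane := a + p.1 • (b - a) + p.2 • (c - a)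

/-- The Jacobian determinant of `affPt a b c`. -/
def jac (a b c : Plane) : ℝ := (b 0 - a 0) * (c 1 - a 1) - (b 1 - a 1) * (c 0 - a 0)

theorem affPt_apply (a b c : Plane) (p : ℝ × ℝ) (i : Fin 2) :
    affPt a b c p i = a i + p.1 * (b i - a i) + p.2 * (c i - a i) := by
  simp [affPt]

theorem continuous_affPt (a b c : Plane) : Continuous (affPt a b c) := by
  unfold affPt; fun_prop

theorem isCompact_refTriangle : IsCompact refTriangle := by
  refine (isCompact_Icc (a := ((0, 0) : ℝ × ℝ)) (b := (1, 1))).of_isClosed_subset ?_ ?_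
  · exact ((isClosed_le continuous_const continuous_fst).inter
      ((isClosed_le continuous_const continuous_snd).inter
        (isClosed_le (continuous_fst.add continuous_snd) continuous_const)))
  · rintro ⟨s, t⟩ ⟨h1, h2, h3⟩
    simp only at h1 h2 h3
    exact ⟨⟨h1, h2⟩, ⟨by simp only; linarith, by simp only; linarith⟩⟩

theorem convex_refTriangle : Convex ℝ refTriangle := by
  rintro ⟨s, t⟩ ⟨h1, h2, h3⟩ ⟨s', t'⟩ ⟨h1', h2', h3'⟩ α β hα hβ h
  simp only at h1 h2 h3 h1' h2' h3'
  refine ⟨?_, ?_, ?_⟩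
  · simp only [Prod.smul_mk, Prod.mk_add_mk, smul_eq_mul]; positivity
  · simp only [Prod.smul_mk, Prod.mk_add_mk, smul_eq_mul]; positivity
  · simp only [Prod.smul_mk, Prod.mk_add_mk, smul_eq_mul]; nlinarith

theorem hull_eq_image (a b c : Plane) : hull {a, b, c} = affPt a b c '' refTriangle := by
  apply Set.Subset.antisymm
  · refine convexHull_min ?_ ?_
    · intro x hx
      simp only [Finset.coe_insert, Finset.coe_singleton, Set.mem_insert_iff,
        Set.mem_singleton_iff] at hx
      rcases hx with rfl | rfl | rfl
      · exact ⟨(0, 0), by simp [refTriangle], by simp [affPt]⟩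
      · exact ⟨(1, 0), by simp [refTriangle], by simp [affPt]⟩
      · exact ⟨(0, 1), by simp [refTriangle], by simp [affPt]⟩
    · rintro _ ⟨p, hp, rfl⟩ _ ⟨q, hq, rfl⟩ α β hα hβ h
      refine ⟨α • p + β • q, convex_refTriangle hp hq hα hβ h, ?_⟩
      obtain rfl : β = 1 - α := by linarith
      ext i
      simp [affPt_apply]
      ring
  · rintro _ ⟨⟨s, t⟩, ⟨h1, h2, h3⟩, rfl⟩
    simp only at h1 h2 h3
    have hm : ∀ x ∈ ({a, b, c} : Finset Plane), x ∈ hull {a, b, c} := fun x hx =>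
      subset_convexHull ℝ _ (Finset.mem_coe.2 hx)
    have := (convex_convexHull ℝ (({a, b, c} : Finset Plane) : Set Plane)).sum_mem
      (t := Finset.univ) (w := ![1 - s - t, s, t]) (z := ![a, b, c])
      (by intro i _; fin_cases i <;> simp <;> linarith)
      (by simp [Fin.sum_univ_three]; ring)
      (by
        intro i _
        fin_cases i
        · exact hm a (by simp)
        · exact hm b (by simp)
        · exact hm c (by simp))
    rw [Fin.sum_univ_three] at this
    unfold hull
    convert this using 1
    ext i
    simp [affPt_apply]
    ring

theorem affPt_injective {a b c : Plane} (h : jac a b c ≠ 0) :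
    Function.Injective (affPt a b c) := by
  rintro ⟨s, t⟩ ⟨s', t'⟩ heq
  have h0 := congrArg (fun x : Plane => x 0) heq
  have h1 := congrArg (fun x : Plane => x 1) heq
  simp only [affPt_apply] at h0 h1
  have hs : jac a b c * (s - s') = 0 := by
    unfold jac; linear_combination (c 1 - a 1) * h0 - (c 0 - a 0) * h1
  have ht : jac a b c * (t - t') = 0 := by
    unfold jac; linear_combination (b 0 - a 0) * h1 - (b 1 - a 1) * h0
  have hs' := (mul_eq_zero.1 hs).resolve_left h
  have ht' := (mul_eq_zero.1 ht).resolve_left h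
  ext <;> simp only <;> linarith

/-- The map factors into the identification of `ℝ × ℝ` with `Fin 2 → ℝ`, the matrix with columns `b
- a` and `c - a`, the passage to the Euclidean norm, and a translation. Only the matrix changes the
volume. -/
theorem map_affPt_volume {a b c : Plane} (h : jac a b c ≠ 0) :
    Measure.map (affPt a b c) volume = ENNReal.ofReal |(jac a b c)⁻¹| • volume := by
  let M : Matrix (Fin 2) (Fin 2) ℝ := !![b 0 - a 0, c 0 - a 0; b 1 - a 1, c 1 - a 1]
  have hdet : M.det = jac a b c := by
    simp only [M, Matrix.det_fin_two_of, jac]; ring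
  have hcomp : affPt a b c = (fun x => a + x) ∘ (WithLp.toLp 2 : (Fin 2 → ℝ) → Plane) ∘
      (Matrix.toLin' M) ∘ MeasurableEquiv.finTwoArrow.symm := by
    funext p
    ext i
    fin_cases i <;>
      simp [affPt_apply, M, MeasurableEquiv.finTwoArrow] <;> ring
  have hM : Measurable (Matrix.toLin' M) :=
    (LinearMap.continuous_of_finiteDimensional (Matrix.toLin' M)).measurable
  have hL : MeasurePreserving (WithLp.toLp 2 : (Fin 2 → ℝ) → Plane) volume volume :=
    PiLp.volume_preserving_toLp (Fin 2)
  have hA : MeasurePreserving (fun x : Plane => a + x) volume volume :=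
    measurePreserving_add_left volume a
  have hF : MeasurePreserving (MeasurableEquiv.finTwoArrow (α := ℝ)).symm volume volume :=
    (volume_preserving_finTwoArrow ℝ).symm _
  rw [hcomp, ← Measure.map_map hA.measurable (hL.measurable.comp (hM.comp hF.measurable)),
    ← Measure.map_map hL.measurable (hM.comp hF.measurable),
    ← Measure.map_map hM hF.measurable, hF.map_eq,
    Real.map_matrix_volume_pi_eq_smul_volume_pi (by rw [hdet]; exact h), Measure.map_smul,
    hL.map_eq, Measure.map_smul, hA.map_eq, hdet]

theorem setIntegral_hull {a b c : Plane} (h : jac a b c ≠ 0) (f : Plane → ℝ) :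
    ∫ x in hull {a, b, c}, f x = |jac a b c| * ∫ p in refTriangle, f (affPt a b c p) := by
  have hemb : MeasurableEmbedding (affPt a b c) :=
    (continuous_affPt a b c).measurableEmbedding (affPt_injective h)
  have h1 : (volume : Measure Plane) =
      ENNReal.ofReal |jac a b c| • Measure.map (affPt a b c) volume := by
    rw [map_affPt_volume h, smul_smul, ← ENNReal.ofReal_mul (abs_nonneg _), ← abs_mul,
      mul_inv_cancel₀ h]
    simp
  rw [h1, Measure.restrict_smul, integral_smul_measure, hemb.setIntegral_map, hull_eq_image,
    (affPt_injective h).preimage_image, ENNReal.toReal_ofReal (abs_nonneg _), smul_eq_mul]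

theorem hull_pair (a b : Plane) : hull {a, b} = AffineMap.lineMap a b '' Set.Icc (0 : ℝ) 1 := by
  rw [hull, Finset.coe_pair, convexHull_pair, segment_eq_image_lineMap]

theorem setIntegral_hull_pair {a b : Plane} (hab : a ≠ b) (f : Plane → ℝ) :
    ∫ x in hull {a, b}, f x ∂(Measure.hausdorffMeasure 1) =
      dist a b * ∫ s in (0 : ℝ)..1, f (AffineMap.lineMap a b s) := by
  set L : ℝ → Plane := ⇑(AffineMap.lineMap a b : ℝ →ᵃ[ℝ] Plane) with hL
  have hinj : Function.Injective L := AffineMap.lineMap_injective (k := ℝ) hab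
  have hemb : MeasurableEmbedding L :=
    (AffineMap.lineMap_continuous : Continuous (AffineMap.lineMap a b : ℝ →ᵃ[ℝ] Plane)).measurableEmbedding hinj
  -- On the line through `a` and `b`, arc length is the pushforward of Lebesgue measure scaled by
  -- `dist a b`, because `lineMap` is a similarity with this ratio.
  have h1 : (Measure.hausdorffMeasure 1 : Measure Plane).restrict (Set.range L) =
      ENNReal.ofReal (dist a b) • Measure.map L volume := by
    ext s hs
    rw [Measure.restrict_apply hs, Measure.smul_apply, hemb.map_apply,
      ← Set.image_preimage_eq_inter_range, hL, hausdorffMeasure_lineMap_image,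
      hausdorffMeasure_real]
    rw [ENNReal.smul_def, ← edist_nndist, edist_dist]
  have h2 : (Measure.hausdorffMeasure 1 : Measure Plane).restrict (hull {a, b}) =
      ENNReal.ofReal (dist a b) • Measure.map L (volume.restrict (Set.Icc 0 1)) := by
    rw [hull_pair, ← hL]
    have : (Measure.hausdorffMeasure 1 : Measure Plane).restrict (L '' Set.Icc 0 1) =
        ((Measure.hausdorffMeasure 1 : Measure Plane).restrict (Set.range L)).restrict
          (L '' Set.Icc 0 1) := by
      rw [Measure.restrict_restrict_of_subset (Set.image_subset_range _ _)]
    rw [this, h1, Measure.restrict_smul, hemb.restrict_map, hinj.preimage_image]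
  rw [h2, integral_smul_measure, hemb.integral_map, ENNReal.toReal_ofReal dist_nonneg,
    smul_eq_mul, intervalIntegral.integral_of_le zero_le_one, integral_Icc_eq_integral_Ioc]

/-! ### The divergence theorem on a triangle -/

theorem setIntegral_refTriangle {f : ℝ × ℝ → ℝ} (hf : Continuous f) :
    ∫ p in refTriangle, f p = ∫ s in (0 : ℝ)..1, ∫ t in (0 : ℝ)..(1 - s), f (s, t) := by
  have hm : MeasurableSet refTriangle := isCompact_refTriangle.measurableSet
  have hint : Integrable (refTriangle.indicator f) :=
    (integrable_indicator_iff hm).2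
      (hf.continuousOn.integrableOn_compact isCompact_refTriangle)
  rw [← integral_indicator hm, Measure.volume_eq_prod, integral_prod _ hint,
    intervalIntegral.integral_of_le zero_le_one, ← integral_Icc_eq_integral_Ioc,
    ← integral_indicator measurableSet_Icc]
  congr 1
  funext s
  by_cases hs : s ∈ Set.Icc (0 : ℝ) 1
  · rw [Set.indicator_of_mem hs, intervalIntegral.integral_of_le (by linarith [hs.2]),
      ← integral_Icc_eq_integral_Ioc, ← integral_indicator measurableSet_Icc]
    congr 1
    funext t
    simp only [Set.indicator, refTriangle, Set.mem_ofPred_eq, Set.mem_Icc]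
    congr 1
    simp only [hs.1, true_and, eq_iff_iff]
    exact and_congr_right fun _ => ⟨fun h => by linarith, fun h => by linarith⟩
  · rw [Set.indicator_of_notMem hs]
    have : ∀ t, refTriangle.indicator f (s, t) = 0 := fun t =>
      Set.indicator_of_notMem (fun h => hs ⟨h.1, by
        have h1 := h.2.1
        have h2 := h.2.2
        simp only at h1 h2
        linarith⟩) _
    simp [this]

/-- Fubini and the fundamental theorem of calculus on vertical slices. One direction suffices, since
the other sides of a triangle are reached by relabelling its vertices. -/
theorem setIntegral_refTriangle_deriv_snd {f f' : ℝ × ℝ → ℝ} (hf : Continuous f)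
    (hf' : Continuous f') (hd : ∀ s t, HasDerivAt (fun t => f (s, t)) (f' (s, t)) t) :
    ∫ p in refTriangle, f' p =
      (∫ s in (0 : ℝ)..1, f (s, 1 - s)) - ∫ s in (0 : ℝ)..1, f (s, 0) := by
  rw [setIntegral_refTriangle hf', ← intervalIntegral.integral_sub
    ((by fun_prop : Continuous fun s => f (s, 1 - s)).intervalIntegrable _ _)
    ((by fun_prop : Continuous fun s => f (s, 0)).intervalIntegrable _ _)]
  congr 1
  funext s
  exact intervalIntegral.integral_eq_sub_of_hasDerivAt (fun t _ => hd s t)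
    ((by fun_prop : Continuous fun t => f' (s, t)).intervalIntegrable _ _)

theorem jac_swap (a b c : Plane) : jac a c b = -jac a b c := by unfold jac; ring

theorem jac_rotate (a b c : Plane) : jac b c a = jac a b c := by unfold jac; ring

theorem ne_of_jac_ne_zero {a b c : Plane} (h : jac a b c ≠ 0) : a ≠ b := by
  rintro rfl; exact h (by unfold jac; ring)

/-- The fundamental theorem of calculus along one side of a triangle. -/
theorem setIntegral_hull_inner_gradient_side {a b c : Plane} (h : jac a b c ≠ 0)
    (q : MvPolynomial (Fin 2) ℝ) :
    ∫ x in hull {a, b, c}, ⟪∇ (polyFun q) x, c - a⟫ =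
      |jac a b c| * ((∫ s in (0 : ℝ)..1, polyFun q (AffineMap.lineMap b c s)) -
        ∫ s in (0 : ℝ)..1, polyFun q (AffineMap.lineMap a b s)) := by
  rw [setIntegral_hull h]
  have hd : ∀ s t, HasDerivAt (fun t => polyFun q (affPt a b c (s, t)))
      ⟪∇ (polyFun q) (affPt a b c (s, t)), c - a⟫ t := by
    intro s t
    rw [inner_gradient_polyFun, ← fderiv_polyFun_apply]
    refine HasFDerivAt.comp_hasDerivAt t
      (hasFDerivAt_polyFun q _).differentiableAt.hasFDerivAt ?_
    unfold affPt
    simpa using ((hasDerivAt_id t).smul_const (c - a)).const_add (a + s • (b - a))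
  rw [setIntegral_refTriangle_deriv_snd (f := fun p => polyFun q (affPt a b c p))
    (f' := fun p => ⟪∇ (polyFun q) (affPt a b c p), c - a⟫)
    ((continuous_polyFun q).comp (continuous_affPt a b c))
    (((continuous_gradient_polyFun q).comp (continuous_affPt a b c)).inner continuous_const) hd]
  congr 2
  -- The point `(s, 1 - s)` runs from the image `c` to the image `b`; the substitution `s ↦ 1 - s`
  -- reverses it.
  · have h1 := intervalIntegral.integral_comp_sub_left
      (fun s => polyFun q (AffineMap.lineMap b c s)) (1 : ℝ) (a := 0) (b := 1)
    simp only [sub_self, sub_zero] at h1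
    rw [← h1]
    congr 1
    funext s
    congr 1
    ext i
    simp [affPt_apply, AffineMap.lineMap_apply]
    ring
  · congr 1
    funext s
    congr 1
    ext i
    simp [affPt_apply, AffineMap.lineMap_apply]
    ring

theorem inner_plane (x y : Plane) : ⟪x, y⟫ = x 0 * y 0 + x 1 * y 1 := by
  rw [PiLp.inner_apply, Fin.sum_univ_two]
  simp [mul_comm]

theorem norm_sq_plane (x : Plane) : ‖x‖ ^ 2 = x 0 ^ 2 + x 1 ^ 2 := by
  rw [← real_inner_self_eq_norm_sq, inner_plane]; ring

/-- The height of a triangle over the side `ab` times the length of this side. -/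
theorem inner_normal_mul_dist {a b c n : Plane} (hn : ‖n‖ = 1) (h0 : ⟪n, a - b⟫ = 0)
    (hpos : 0 ≤ ⟪n, a - c⟫) : ⟪n, a - c⟫ * dist a b = |jac a b c| := by
  rw [← abs_of_nonneg (mul_nonneg hpos dist_nonneg), ← sq_eq_sq_iff_abs_eq_abs, mul_pow,
    dist_eq_norm, norm_sq_plane]
  have hn2 := norm_sq_plane n
  rw [hn] at hn2
  rw [inner_plane] at h0 ⊢
  simp only [PiLp.sub_apply] at h0 ⊢
  -- Since `b - a` is orthogonal to the unit vector `n`, it is `κ` times `n` rotated by a quarter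
  -- turn, and `κ² = dist a b ^ 2`.
  set κ := (b 1 - a 1) * n 0 - (b 0 - a 0) * n 1 with hκ
  have e0 : b 0 - a 0 = -κ * n 1 := by
    rw [hκ]; linear_combination (b 0 - a 0) * hn2 - n 0 * h0
  have e1 : b 1 - a 1 = κ * n 0 := by
    rw [hκ]; linear_combination (b 1 - a 1) * hn2 - n 1 * h0
  have e2 : jac a b c = κ * (n 0 * (a 0 - c 0) + n 1 * (a 1 - c 1)) := by
    unfold jac; rw [e0, e1]; ring
  have e3 : (a 0 - b 0) ^ 2 + (a 1 - b 1) ^ 2 = κ ^ 2 := by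
    have : (a 0 - b 0) ^ 2 + (a 1 - b 1) ^ 2 = (b 0 - a 0) ^ 2 + (b 1 - a 1) ^ 2 := by ring
    rw [this, e0, e1]; linear_combination -κ ^ 2 * hn2
  rw [e2, e3]; ring

/-- The divergence theorem on a triangle for a field with a fixed direction. -/
theorem setIntegral_hull_inner_gradient {a b c na nb nc : Plane} (h : jac a b c ≠ 0)
    (hna : ‖na‖ = 1) (hnb : ‖nb‖ = 1) (hnc : ‖nc‖ = 1)
    (oa : ⟪na, b - c⟫ = 0) (ob : ⟪nb, a - c⟫ = 0) (oc : ⟪nc, a - b⟫ = 0)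
    (pa : 0 < ⟪na, b - a⟫) (pb : 0 < ⟪nb, c - b⟫) (pc : 0 < ⟪nc, a - c⟫)
    (q : MvPolynomial (Fin 2) ℝ) (ξ : Plane) :
    ∫ x in hull {a, b, c}, ⟪∇ (polyFun q) x, ξ⟫ =
      ⟪na, ξ⟫ * (∫ x in hull {b, c}, polyFun q x ∂(Measure.hausdorffMeasure 1)) +
      ⟪nb, ξ⟫ * (∫ x in hull {a, c}, polyFun q x ∂(Measure.hausdorffMeasure 1)) +
      ⟪nc, ξ⟫ * ∫ x in hull {a, b}, polyFun q x ∂(Measure.hausdorffMeasure 1) := by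
  have hint : ∀ i : Fin 2, IntegrableOn (polyFun (MvPolynomial.pderiv i q)) (hull {a, b, c}) :=
    fun i => integrableOn_polyFun_hull _ _
  set I : Fin 2 → ℝ := fun i => ∫ x in hull {a, b, c}, polyFun (MvPolynomial.pderiv i q) x
  have hI : ∀ ξ : Plane, ∫ x in hull {a, b, c}, ⟪∇ (polyFun q) x, ξ⟫ = I 0 * ξ 0 + I 1 * ξ 1 := by
    intro ξ
    simp only [inner_gradient_polyFun, Fin.sum_univ_two]
    rw [integral_add ((hint 0).mul_const _) ((hint 1).mul_const _), integral_mul_const,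
      integral_mul_const]
  have hbca : jac b c a ≠ 0 := by rwa [jac_rotate]
  have hacb : jac a c b ≠ 0 := by rw [jac_swap]; exact neg_ne_zero.2 h
  have eab := setIntegral_hull_pair (ne_of_jac_ne_zero h) (polyFun q)
  have ebc := setIntegral_hull_pair (ne_of_jac_ne_zero hbca) (polyFun q)
  have eac := setIntegral_hull_pair (ne_of_jac_ne_zero hacb) (polyFun q)
  -- The side formula for the labelling `a c b` traverses the edge from `c` to `b`. Both
  -- orientations parametrize the same Hausdorff integral.
  have ecb := setIntegral_hull_pair (ne_of_jac_ne_zero hbca).symm (polyFun q)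
  rw [Finset.pair_comm c b, dist_comm c b] at ecb
  have dcb : (∫ s in (0 : ℝ)..1, polyFun q (AffineMap.lineMap c b s)) =
      ∫ s in (0 : ℝ)..1, polyFun q (AffineMap.lineMap b c s) :=
    mul_left_cancel₀ (dist_ne_zero.2 (ne_of_jac_ne_zero hbca)) (ecb.symm.trans ebc)
  have s1 := setIntegral_hull_inner_gradient_side h q
  have s2 := setIntegral_hull_inner_gradient_side hacb q
  have hperm : ({a, c, b} : Finset Plane) = {a, b, c} := by
    rw [Finset.pair_comm]
  rw [hperm, jac_swap, abs_neg, dcb] at s2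
  rw [hI] at s1 s2 ⊢
  have la : ⟪na, b - a⟫ * dist b c = |jac a b c| := by
    rw [inner_normal_mul_dist hna oa pa.le, jac_rotate]
  have lb : ⟪nb, c - b⟫ * dist a c = |jac a b c| := by
    have e : ⟪nb, c - b⟫ = ⟪nb, a - b⟫ := by
      have : a - b = (a - c) + (c - b) := by abel
      rw [this, inner_add_right, ob, zero_add]
    rw [e, inner_normal_mul_dist hnb ob (by rw [← e]; exact pb.le), jac_swap, abs_neg]
  have lc : ⟪nc, a - c⟫ * dist a b = |jac a b c| := inner_normal_mul_dist hnc oc pc.le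
  rw [eab, ebc, eac]
  simp only [inner_plane, PiLp.sub_apply] at *
  set A := ∫ s in (0 : ℝ)..1, polyFun q (AffineMap.lineMap b c s)
  set B := ∫ s in (0 : ℝ)..1, polyFun q (AffineMap.lineMap a c s)
  set C := ∫ s in (0 : ℝ)..1, polyFun q (AffineMap.lineMap a b s)
  have hR : ∀ ξ0 ξ1 : ℝ, (na 0 * ξ0 + na 1 * ξ1) * (dist b c * A) +
      (nb 0 * ξ0 + nb 1 * ξ1) * (dist a c * B) + (nc 0 * ξ0 + nc 1 * ξ1) * (dist a b * C) =
      (na 0 * dist b c * A + nb 0 * dist a c * B + nc 0 * dist a b * C) * ξ0 +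
      (na 1 * dist b c * A + nb 1 * dist a c * B + nc 1 * dist a b * C) * ξ1 := by
    intros; ring
  rw [hR]
  set R0 := na 0 * dist b c * A + nb 0 * dist a c * B + nc 0 * dist a b * C
  set R1 := na 1 * dist b c * A + nb 1 * dist a c * B + nc 1 * dist a b * C
  -- The vector `I = ∫ ∇q` and the boundary vector `R` have the same products with `c - a` and `b -
  -- a`: base times height equals `|jac|` for each edge, and this converts the side formulas into
  -- normal components. As `jac ≠ 0`, these two vectors span the plane, so Cramer's rule gives `I =
  -- R`.
  have r1 : I 0 * (c 0 - a 0) + I 1 * (c 1 - a 1) = R0 * (c 0 - a 0) + R1 * (c 1 - a 1) := by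
    rw [s1]
    linear_combination (-A) * la + C * lc + dist b c * A * oa + dist a c * B * ob
  have r2 : I 0 * (b 0 - a 0) + I 1 * (b 1 - a 1) = R0 * (b 0 - a 0) + R1 * (b 1 - a 1) := by
    rw [s2]
    linear_combination (-A) * la + B * lb + dist a c * B * ob + dist a b * C * oc
  have d0 : jac a b c * (I 0 - R0) = 0 := by
    unfold jac; linear_combination (c 1 - a 1) * r2 - (b 1 - a 1) * r1
  have d1 : jac a b c * (I 1 - R1) = 0 := by
    unfold jac; linear_combination (b 0 - a 0) * r1 - (c 0 - a 0) * r2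
  have d0' := (mul_eq_zero.1 d0).resolve_left h
  have d1' := (mul_eq_zero.1 d1).resolve_left h
  linear_combination ξ 0 * d0' + ξ 1 * d1'

/-! ### Equivalence of quadratic forms on polynomials over the reference triangle -/

theorem exists_bilin_le_norm_sq {V : Type*} [NormedAddCommGroup V] [InnerProductSpace ℝ V]
    [FiniteDimensional ℝ V] (A : V →ₗ[ℝ] V →ₗ[ℝ] ℝ) :
    ∃ C : ℝ, 0 < C ∧ ∀ x, A x x ≤ C * ‖x‖ ^ 2 := by
  refine ⟨‖A.toContinuousBilinearMap‖ + 1, by positivity, fun x => ?_⟩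
  have h2 : A x x ≤ ‖A.toContinuousBilinearMap‖ * ‖x‖ * ‖x‖ :=
    (le_abs_self _).trans (A.toContinuousBilinearMap.le_opNorm₂ x x)
  nlinarith [sq_nonneg ‖x‖]

/-- The form `B` is made the inner product of `V`; in finite dimension every bilinear form is then
bounded by its norm. This is the source of all constants that depend on a polynomial degree. -/
theorem exists_bilin_le_of_posDef {V : Type*} [AddCommGroup V] [Module ℝ V]
    [FiniteDimensional ℝ V] (A B : V →ₗ[ℝ] V →ₗ[ℝ] ℝ) (hsymm : ∀ x y, B x y = B y x)
    (hpos : ∀ x, x ≠ 0 → 0 < B x x) : ∃ C : ℝ, 0 < C ∧ ∀ x, A x x ≤ C * B x x := by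
  let core : InnerProductSpace.Core ℝ V :=
    { inner := fun x y => B x y
      conj_inner_symm := fun x y => by simp [hsymm x y]
      re_inner_nonneg := fun x => by
        by_cases h : x = 0
        · simp [h]
        · exact (hpos x h).le
      add_left := fun x y z => by simp
      smul_left := fun x y r => by simp
      definite := fun x h => by
        by_contra hx
        exact (hpos x hx).ne' h }
  obtain ⟨C, hC, h⟩ := @exists_bilin_le_norm_sq V core.toNormedAddCommGroup
    (InnerProductSpace.ofCore core.toCore) _ A
  refine ⟨C, hC, fun x => (h x).trans_eq ?_⟩
  exact congrArg (C * ·) (@real_inner_self_eq_norm_sq V core.toNormedAddCommGroup.toSeminormedAddCommGroup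
    (InnerProductSpace.ofCore core.toCore) x).symm

/-- The bilinear form `(x, y) ↦ ∫ w (E x) (E y)`. -/
noncomputable def weightedForm {V α : Type*} [AddCommGroup V] [Module ℝ V] [MeasurableSpace α]
    (μ : Measure α) (w : α → ℝ) (E : V →ₗ[ℝ] α → ℝ)
    (hE : ∀ x y, Integrable (fun a => w a * (E x a * E y a)) μ) : V →ₗ[ℝ] V →ₗ[ℝ] ℝ :=
  LinearMap.mk₂ ℝ (fun x y => ∫ a, w a * (E x a * E y a) ∂μ)
    (fun x y z => by
      simp only [map_add, Pi.add_apply, add_mul, mul_add]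
      exact integral_add (hE _ _) (hE _ _))
    (fun c x y => by
      simp only [map_smul, Pi.smul_apply, smul_eq_mul, mul_assoc, mul_left_comm _ c,
        integral_const_mul])
    (fun x y z => by
      simp only [map_add, Pi.add_apply, mul_add]
      exact integral_add (hE _ _) (hE _ _))
    (fun c x y => by
      simp only [map_smul, Pi.smul_apply, smul_eq_mul, mul_left_comm _ c,
        integral_const_mul])

theorem exists_integral_sq_le {V α β : Type*} [AddCommGroup V] [Module ℝ V]
    [FiniteDimensional ℝ V] [MeasurableSpace α] [MeasurableSpace β]
    (μ : Measure α) (ν : Measure β) (w : β → ℝ) (E : V →ₗ[ℝ] α → ℝ) (F : V →ₗ[ℝ] β → ℝ)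
    (hE : ∀ x y, Integrable (fun a => E x a * E y a) μ)
    (hF : ∀ x y, Integrable (fun b => w b * (F x b * F y b)) ν)
    (hpos : ∀ x, x ≠ 0 → 0 < ∫ b, w b * (F x b * F x b) ∂ν) :
    ∃ C : ℝ, 0 < C ∧ ∀ x, ∫ a, E x a * E x a ∂μ ≤ C * ∫ b, w b * (F x b * F x b) ∂ν := by
  obtain ⟨C, hC, h⟩ := exists_bilin_le_of_posDef
    (weightedForm μ (fun _ => 1) E (by simpa using hE)) (weightedForm ν w F hF)
    (fun x y => by simp only [weightedForm, LinearMap.mk₂_apply, mul_comm (F x _)])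
    (fun x hx => by simpa only [weightedForm, LinearMap.mk₂_apply] using hpos x hx)
  refine ⟨C, hC, fun x => ?_⟩
  simpa only [weightedForm, LinearMap.mk₂_apply, one_mul] using h x

/-- If the integral vanished, the nonnegative integrand would be zero almost everywhere, hence, by
continuity, everywhere on the open set `U`, where the weight is positive. -/
theorem setIntegral_weighted_sq_pos {X : Type*} [TopologicalSpace X] [MeasurableSpace X]
    [BorelSpace X] {μ : Measure X} [μ.IsOpenPosMeasure] {S U : Set X} (hS : MeasurableSet S)
    (hU : IsOpen U) (hUS : U ⊆ S) {w f : X → ℝ} (hw : Continuous w) (hf : Continuous f)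
    (hw0 : ∀ x ∈ S, 0 ≤ w x) (hwU : ∀ x ∈ U, 0 < w x)
    (hint : IntegrableOn (fun x => w x * (f x * f x)) S μ) (hne : ∃ x ∈ U, f x ≠ 0) :
    0 < ∫ x in S, w x * (f x * f x) ∂μ := by
  have hnn : 0 ≤ᵐ[μ.restrict S] fun x => w x * (f x * f x) :=
    (ae_restrict_iff' hS).2 (Filter.Eventually.of_forall fun x hx =>
      mul_nonneg (hw0 x hx) (mul_self_nonneg _))
  refine lt_of_le_of_ne (integral_nonneg_of_ae hnn) fun h => ?_
  have h1 := (integral_eq_zero_iff_of_nonneg_ae hnn hint).1 h.symm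
  have h2 : (fun x => w x * (f x * f x)) =ᵐ[μ.restrict U] fun _ => 0 :=
    ae_restrict_of_ae_restrict_of_subset hUS h1
  have h3 := Measure.eqOn_open_of_ae_eq h2 hU (hw.mul (hf.mul hf)).continuousOn
    continuousOn_const
  obtain ⟨x, hx, hfx⟩ := hne
  have h4 := h3 hx
  simp only at h4
  have := mul_pos (hwU x hx) (mul_self_pos.2 hfx)
  linarith

/-! ### Inequalities for polynomials on the reference triangle and the reference edge -/

/-- The open reference triangle. -/
def openRefTriangle : Set (ℝ × ℝ) := {p | 0 < p.1 ∧ 0 < p.2 ∧ p.1 + p.2 < 1}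

theorem isOpen_openRefTriangle : IsOpen openRefTriangle :=
  (isOpen_lt continuous_const continuous_fst).inter
    ((isOpen_lt continuous_const continuous_snd).inter
      (isOpen_lt (continuous_fst.add continuous_snd) continuous_const))

theorem openRefTriangle_subset : openRefTriangle ⊆ refTriangle :=
  fun _ h => ⟨h.1.le, h.2.1.le, h.2.2.le⟩

/-- A polynomial in two variables as a function on `ℝ × ℝ`. -/
noncomputable def pairEval : MvPolynomial (Fin 2) ℝ →ₗ[ℝ] ℝ × ℝ → ℝ where
  toFun p x := MvPolynomial.eval ![x.1, x.2] p
  map_add' p q := by ext; simp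
  map_smul' c p := by ext; simp

theorem continuous_pairEval (p : MvPolynomial (Fin 2) ℝ) : Continuous (pairEval p) := by
  have : Continuous fun x : ℝ × ℝ => (![x.1, x.2] : Fin 2 → ℝ) :=
    continuous_pi fun i => by fin_cases i <;> simp <;> fun_prop
  exact (MvPolynomial.continuous_eval p).comp this

/-- The square `(0, 1/2)²` lies in the open triangle, and a nonzero polynomial cannot vanish on a
product of infinite sets. -/
theorem exists_pairEval_ne_zero {p : MvPolynomial (Fin 2) ℝ} (hp : p ≠ 0) :
    ∃ x ∈ openRefTriangle, pairEval p x ≠ 0 := by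
  by_contra! h
  refine hp (MvPolynomial.funext_set (fun _ : Fin 2 => Set.Ioo (0 : ℝ) (1 / 2))
    (fun _ => Set.Ioo_infinite (by norm_num)) fun y hy => ?_)
  have h0 := hy 0 (Set.mem_univ _)
  have h1 := hy 1 (Set.mem_univ _)
  have := h (y 0, y 1) ⟨h0.1, h1.1, by simp only; linarith [h0.2, h1.2]⟩
  have e : ![y 0, y 1] = y := by ext i; fin_cases i <;> rfl
  simpa [pairEval, e] using this

theorem integrableOn_refTriangle {f : ℝ × ℝ → ℝ} (hf : Continuous f) :
    IntegrableOn f refTriangle :=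
  hf.continuousOn.integrableOn_compact isCompact_refTriangle

theorem integral_weighted_pairEval_pos {w : ℝ × ℝ → ℝ} (hw : Continuous w)
    (hw0 : ∀ x ∈ refTriangle, 0 ≤ w x) (hwU : ∀ x ∈ openRefTriangle, 0 < w x)
    {p : MvPolynomial (Fin 2) ℝ} (hp : p ≠ 0) :
    0 < ∫ x in refTriangle, w x * (pairEval p x * pairEval p x) :=
  setIntegral_weighted_sq_pos isCompact_refTriangle.measurableSet isOpen_openRefTriangle
    openRefTriangle_subset hw (continuous_pairEval p) hw0 hwU
    (integrableOn_refTriangle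
      (hw.mul ((continuous_pairEval p).mul (continuous_pairEval p))))
    (exists_pairEval_ne_zero hp)

/-- The bubble is positive inside the triangle, so the weighted form is still positive definite on
polynomials. -/
theorem exists_ref_bubble_bound (m : ℕ) : ∃ C : ℝ, 0 < C ∧ ∀ p : MvPolynomial (Fin 2) ℝ,
    p.totalDegree ≤ m →
    ∫ x in refTriangle, pairEval p x * pairEval p x ≤
      C * ∫ x in refTriangle, ((1 - x.1 - x.2) * x.1 * x.2) * (pairEval p x * pairEval p x) := by
  have hw : Continuous fun x : ℝ × ℝ => (1 - x.1 - x.2) * x.1 * x.2 := by fun_prop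
  have hc : ∀ p q, Continuous fun x => pairEval p x * pairEval q x := fun p q =>
    (continuous_pairEval p).mul (continuous_pairEval q)
  let V := MvPolynomial.restrictTotalDegree (Fin 2) ℝ m
  obtain ⟨C, hC, h⟩ := exists_integral_sq_le (volume.restrict refTriangle)
    (volume.restrict refTriangle) (fun x : ℝ × ℝ => (1 - x.1 - x.2) * x.1 * x.2)
    (pairEval ∘ₗ V.subtype) (pairEval ∘ₗ V.subtype)
    (fun p q => integrableOn_refTriangle (hc _ _))
    (fun p q => integrableOn_refTriangle (hw.mul (hc _ _)))
    (fun p hp => integral_weighted_pairEval_pos hw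
      (fun x hx => mul_nonneg (mul_nonneg (by linarith [hx.2.2]) hx.1) hx.2.1)
      (fun x hx => mul_pos (mul_pos (by linarith [hx.2.2]) hx.1) hx.2.1)
      (fun h0 => hp (Subtype.ext h0)))
  exact ⟨C, hC, fun p hp => h ⟨p, (MvPolynomial.mem_restrictTotalDegree _ _ _).2 hp⟩⟩

theorem integrable_restrict_Ioc {f : ℝ → ℝ} (hf : Continuous f) :
    Integrable f (volume.restrict (Set.Ioc 0 1)) :=
  (hf.continuousOn.integrableOn_compact isCompact_Icc).mono_set Set.Ioc_subset_Icc_self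

theorem exists_ref_trace_bound (m : ℕ) : ∃ C : ℝ, 0 < C ∧ ∀ p : MvPolynomial (Fin 2) ℝ,
    p.totalDegree ≤ m →
    ∫ s in (0 : ℝ)..1, pairEval p (s, 0) * pairEval p (s, 0) ≤
      C * ∫ x in refTriangle, pairEval p x * pairEval p x := by
  have hc : ∀ p q, Continuous fun x => pairEval p x * pairEval q x := fun p q =>
    (continuous_pairEval p).mul (continuous_pairEval q)
  let V := MvPolynomial.restrictTotalDegree (Fin 2) ℝ m
  obtain ⟨C, hC, h⟩ := exists_integral_sq_le (volume.restrict (Set.Ioc (0 : ℝ) 1))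
    (volume.restrict refTriangle) (fun _ => 1)
    (LinearMap.funLeft ℝ ℝ (fun s : ℝ => (s, (0 : ℝ))) ∘ₗ pairEval ∘ₗ V.subtype)
    (pairEval ∘ₗ V.subtype)
    (fun p q => integrable_restrict_Ioc ((hc p.1 q.1).comp (by fun_prop :
      Continuous fun s : ℝ => (s, (0 : ℝ)))))
    (fun p q => integrableOn_refTriangle (continuous_const.mul (hc _ _)))
    (fun p hp => integral_weighted_pairEval_pos continuous_const
      (fun x hx => zero_le_one) (fun x hx => zero_lt_one)
      (fun h0 => hp (Subtype.ext h0)))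
  refine ⟨C, hC, fun p hp => ?_⟩
  rw [intervalIntegral.integral_of_le zero_le_one]
  have := h ⟨p, (MvPolynomial.mem_restrictTotalDegree _ _ _).2 hp⟩
  simp only [one_mul] at this
  exact this

/-- A polynomial in one variable as a function on the line. -/
noncomputable def realEval : Polynomial ℝ →ₗ[ℝ] ℝ → ℝ where
  toFun P s := P.eval s
  map_add' p q := by ext; simp
  map_smul' c p := by ext; simp

/-- The two inequalities needed for the edge test function: extending `P` to the triangle as a
function of the first coordinate is bounded in `L²`, and the quadratic edge bubble `(1 - s) s` may
be inserted at the price of a constant. -/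
theorem exists_ref_edge_bound (m : ℕ) : ∃ C : ℝ, 0 < C ∧ ∀ P : Polynomial ℝ, P.natDegree ≤ m →
    (∫ x in refTriangle, P.eval x.1 * P.eval x.1 ≤
      C * ∫ s in (0 : ℝ)..1, P.eval s * P.eval s) ∧
    ∫ s in (0 : ℝ)..1, P.eval s * P.eval s ≤
      C * ∫ s in (0 : ℝ)..1, ((1 - s) * s) * (P.eval s * P.eval s) := by
  -- `degreeLT` is a strict bound, hence `m + 1` for degree at most `m`.
  let V := Polynomial.degreeLT ℝ (m + 1)
  have hV : ∀ P : Polynomial ℝ, P.natDegree ≤ m → P ∈ V := fun P hP => by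
    rw [Polynomial.mem_degreeLT]
    exact (Polynomial.degree_le_of_natDegree_le hP).trans_lt (Nat.cast_lt.2 m.lt_succ_self)
  have hfd : FiniteDimensional ℝ V :=
    Module.Finite.equiv (Polynomial.degreeLTEquiv ℝ (m + 1)).symm
  have hc : ∀ p q : Polynomial ℝ, Continuous fun s => p.eval s * q.eval s := fun p q => by fun_prop
  have hpos : ∀ w : ℝ → ℝ, Continuous w → (∀ s ∈ Set.Ioc (0 : ℝ) 1, 0 ≤ w s) →
      (∀ s ∈ Set.Ioo (0 : ℝ) 1, 0 < w s) → ∀ P : V, P ≠ 0 →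
      0 < ∫ s in Set.Ioc (0 : ℝ) 1, w s * (P.1.eval s * P.1.eval s) := by
    intro w hw hw0 hwU P hP
    refine setIntegral_weighted_sq_pos measurableSet_Ioc isOpen_Ioo Set.Ioo_subset_Ioc_self hw
      P.1.continuous hw0 hwU (integrable_restrict_Ioc (hw.mul (hc _ _))) ?_
    by_contra! h
    exact hP (Subtype.ext (Polynomial.eq_zero_of_infinite_isRoot P.1
      ((Set.Ioo_infinite (zero_lt_one' ℝ)).mono fun s hs => h s hs)))
  obtain ⟨C₁, hC₁, h₁⟩ := exists_integral_sq_le (volume.restrict refTriangle)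
    (volume.restrict (Set.Ioc (0 : ℝ) 1)) (fun _ => 1)
    (LinearMap.funLeft ℝ ℝ (Prod.fst : ℝ × ℝ → ℝ) ∘ₗ realEval ∘ₗ V.subtype)
    (realEval ∘ₗ V.subtype)
    (fun p q => integrableOn_refTriangle ((hc p.1 q.1).comp continuous_fst))
    (fun p q => integrable_restrict_Ioc (continuous_const.mul (hc _ _)))
    (hpos _ continuous_const (fun _ _ => zero_le_one) fun _ _ => zero_lt_one)
  have hw : Continuous fun s : ℝ => (1 - s) * s := by fun_prop
  obtain ⟨C₂, hC₂, h₂⟩ := exists_integral_sq_le (volume.restrict (Set.Ioc (0 : ℝ) 1))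
    (volume.restrict (Set.Ioc (0 : ℝ) 1)) (fun s => (1 - s) * s)
    (realEval ∘ₗ V.subtype) (realEval ∘ₗ V.subtype)
    (fun p q => integrable_restrict_Ioc (hc _ _))
    (fun p q => integrable_restrict_Ioc (hw.mul (hc _ _)))
    (hpos _ hw (fun s hs => mul_nonneg (by linarith [hs.2]) hs.1.le)
      fun s hs => mul_pos (by linarith [hs.2]) hs.1)
  refine ⟨max C₁ C₂, lt_max_of_lt_left hC₁, fun P hP => ?_⟩
  simp only [intervalIntegral.integral_of_le (zero_le_one' ℝ)]
  constructor
  · have h := h₁ ⟨P, hV P hP⟩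
    simp only [one_mul] at h
    exact h.trans (mul_le_mul_of_nonneg_right (le_max_left _ _)
      (integral_nonneg fun s => mul_self_nonneg _))
  · exact (h₂ ⟨P, hV P hP⟩).trans (mul_le_mul_of_nonneg_right (le_max_right _ _)
      (setIntegral_nonneg measurableSet_Ioc fun s hs =>
        mul_nonneg (mul_nonneg (by linarith [hs.2]) hs.1.le) (mul_self_nonneg _)))

/-! ### Integrals of polynomials over triangles and edges -/

theorem integrableOn_polyFun_edge (p : MvPolynomial (Fin 2) ℝ) (a b : Plane) :
    IntegrableOn (polyFun p) (hull {a, b}) (Measure.hausdorffMeasure 1) := by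
  have hfin : Measure.hausdorffMeasure 1 (hull {a, b}) ≠ ⊤ := by
    simp [hull, convexHull_pair, edist_ne_top]
  obtain ⟨M, hM⟩ := (isCompact_hull {a, b}).exists_bound_of_continuousOn
    (continuous_polyFun p).continuousOn
  exact IntegrableOn.of_bound hfin.lt_top (continuous_polyFun p).aestronglyMeasurable M
    ((ae_restrict_iff' (isCompact_hull _).measurableSet).2 (Filter.Eventually.of_forall hM))

/-- The integral of a polynomial over a triangle. -/
noncomputable def triInt (K : Finset Plane) : MvPolynomial (Fin 2) ℝ →ₗ[ℝ] ℝ where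
  toFun p := ∫ x in hull K, polyFun p x
  map_add' p q := by
    simp only [polyFun_add]
    exact integral_add (integrableOn_polyFun_hull p K) (integrableOn_polyFun_hull q K)
  map_smul' r p := by
    simp only [MvPolynomial.smul_eq_C_mul, polyFun_mul, polyFun_C, integral_const_mul,
      RingHom.id_apply, smul_eq_mul]

/-- The integral of a polynomial over an edge. -/
noncomputable def edgeInt (a b : Plane) : MvPolynomial (Fin 2) ℝ →ₗ[ℝ] ℝ where
  toFun p := ∫ x in hull {a, b}, polyFun p x ∂(Measure.hausdorffMeasure 1)
  map_add' p q := by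
    simp only [polyFun_add]
    exact integral_add (integrableOn_polyFun_edge p a b) (integrableOn_polyFun_edge q a b)
  map_smul' r p := by
    simp only [MvPolynomial.smul_eq_C_mul, polyFun_mul, polyFun_C, integral_const_mul,
      RingHom.id_apply, smul_eq_mul]

theorem triInt_apply (K : Finset Plane) (p : MvPolynomial (Fin 2) ℝ) :
    triInt K p = ∫ x in hull K, polyFun p x := rfl

theorem edgeInt_apply (a b : Plane) (p : MvPolynomial (Fin 2) ℝ) :
    edgeInt a b p = ∫ x in hull {a, b}, polyFun p x ∂(Measure.hausdorffMeasure 1) := rfl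

theorem triInt_sq_nonneg (K : Finset Plane) (p : MvPolynomial (Fin 2) ℝ) :
    0 ≤ triInt K (p * p) :=
  integral_nonneg fun x => by rw [polyFun_mul]; exact mul_self_nonneg _

theorem edgeInt_sq_nonneg (a b : Plane) (p : MvPolynomial (Fin 2) ℝ) :
    0 ≤ edgeInt a b (p * p) :=
  integral_nonneg fun x => by rw [polyFun_mul]; exact mul_self_nonneg _

theorem edgeInt_eq_zero {a b : Plane} {p : MvPolynomial (Fin 2) ℝ}
    (h : ∀ x ∈ hull {a, b}, polyFun p x = 0) : edgeInt a b p = 0 :=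
  setIntegral_eq_zero_of_forall_eq_zero h

theorem triInt_eq {a b c : Plane} (h : jac a b c ≠ 0) (p : MvPolynomial (Fin 2) ℝ) :
    triInt {a, b, c} p = |jac a b c| * ∫ x in refTriangle, polyFun p (affPt a b c x) :=
  setIntegral_hull h _

theorem edgeInt_eq {a b : Plane} (h : a ≠ b) (p : MvPolynomial (Fin 2) ℝ) :
    edgeInt a b p = dist a b * ∫ s in (0 : ℝ)..1, polyFun p (AffineMap.lineMap a b s) :=
  setIntegral_hull_pair h _

/-- Young's inequality for a nonnegative form on polynomials. -/
theorem two_mul_le_of_sq_nonneg {I : MvPolynomial (Fin 2) ℝ →ₗ[ℝ] ℝ} (hI : ∀ p, 0 ≤ I (p * p))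
    (p q : MvPolynomial (Fin 2) ℝ) {A : ℝ} (hA : 0 < A) :
    2 * I (p * q) ≤ A * I (p * p) + A⁻¹ * I (q * q) := by
  have h := hI (A • p - q)
  have e : (A • p - q) * (A • p - q) = (A ^ 2) • (p * p) - (2 * A) • (p * q) + q * q := by
    simp only [MvPolynomial.smul_eq_C_mul, map_mul, map_pow, map_ofNat]; ring
  rw [e, map_add, map_sub, map_smul, map_smul, smul_eq_mul, smul_eq_mul] at h
  have h2 := mul_nonneg (inv_pos.2 hA).le h
  have e2 : A⁻¹ * (A ^ 2 * I (p * p) - 2 * A * I (p * q) + I (q * q)) =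
      A * I (p * p) - 2 * I (p * q) + A⁻¹ * I (q * q) := by
    field_simp
  linarith

/-! ### Barycentric coordinates and pullbacks -/

/-- The barycentric coordinate of the triangle `a b c` which belongs to the vertex `c`. -/
noncomputable def bary (a b c : Plane) : MvPolynomial (Fin 2) ℝ :=
  MvPolynomial.C ((b 0 - a 0) / jac a b c) * (MvPolynomial.X 1 - MvPolynomial.C (a 1)) -
    MvPolynomial.C ((b 1 - a 1) / jac a b c) * (MvPolynomial.X 0 - MvPolynomial.C (a 0))

/-- A barycentric coordinate is a ratio of signed areas. -/
theorem polyFun_bary (a b c x : Plane) : polyFun (bary a b c) x = jac a b x / jac a b c := by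
  simp only [bary, polyFun_sub, polyFun_mul, polyFun_C, polyFun_X]
  rw [show jac a b x = (b 0 - a 0) * (x 1 - a 1) - (b 1 - a 1) * (x 0 - a 0) from rfl]
  ring

theorem totalDegree_X_sub_C_le (i : Fin 2) (r : ℝ) :
    (MvPolynomial.X i - MvPolynomial.C r : MvPolynomial (Fin 2) ℝ).totalDegree ≤ 1 :=
  (MvPolynomial.totalDegree_sub_C_le _ _).trans (by simp)

theorem totalDegree_C_mul_le {p : MvPolynomial (Fin 2) ℝ} {m : ℕ} (h : p.totalDegree ≤ m) (r : ℝ) :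
    (MvPolynomial.C r * p).totalDegree ≤ m := by
  rw [← MvPolynomial.smul_eq_C_mul]
  exact (MvPolynomial.totalDegree_smul_le _ _).trans h

theorem totalDegree_sub_le' {p q : MvPolynomial (Fin 2) ℝ} {m : ℕ} (hp : p.totalDegree ≤ m)
    (hq : q.totalDegree ≤ m) : (p - q).totalDegree ≤ m :=
  (MvPolynomial.totalDegree_sub _ _).trans (max_le hp hq)

theorem totalDegree_mul_le' {p q : MvPolynomial (Fin 2) ℝ} {m n : ℕ} (hp : p.totalDegree ≤ m)
    (hq : q.totalDegree ≤ n) : (p * q).totalDegree ≤ m + n :=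
  (MvPolynomial.totalDegree_mul _ _).trans (add_le_add hp hq)

theorem totalDegree_bary_le (a b c : Plane) : (bary a b c).totalDegree ≤ 1 :=
  totalDegree_sub_le' (totalDegree_C_mul_le (totalDegree_X_sub_C_le _ _) _)
    (totalDegree_C_mul_le (totalDegree_X_sub_C_le _ _) _)

/-- The barycentric coordinate which belongs to the vertex `a`. -/
noncomputable def bary₀ (a b c : Plane) : MvPolynomial (Fin 2) ℝ :=
  1 - bary a c b - bary a b c

theorem totalDegree_bary₀_le (a b c : Plane) : (bary₀ a b c).totalDegree ≤ 1 :=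
  totalDegree_sub_le' (totalDegree_sub_le' (by simp) (totalDegree_bary_le _ _ _))
    (totalDegree_bary_le _ _ _)

theorem polyFun_bary_affPt {a b c : Plane} (h : jac a b c ≠ 0) (x : ℝ × ℝ) :
    polyFun (bary a b c) (affPt a b c x) = x.2 := by
  rw [polyFun_bary, div_eq_iff h]
  simp only [jac, affPt_apply]
  ring

theorem polyFun_bary_affPt_fst {a b c : Plane} (h : jac a b c ≠ 0) (x : ℝ × ℝ) :
    polyFun (bary a c b) (affPt a b c x) = x.1 := by
  rw [polyFun_bary, div_eq_iff (by rw [jac_swap]; exact neg_ne_zero.2 h)]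
  simp only [jac, affPt_apply]
  ring

theorem polyFun_bary₀_affPt {a b c : Plane} (h : jac a b c ≠ 0) (x : ℝ × ℝ) :
    polyFun (bary₀ a b c) (affPt a b c x) = 1 - x.1 - x.2 := by
  simp only [bary₀, polyFun_sub, polyFun_one, polyFun_bary_affPt h, polyFun_bary_affPt_fst h]

theorem lineMap_eq_affPt (a b c : Plane) (s : ℝ) :
    AffineMap.lineMap a b s = affPt a b c (s, 0) := by
  ext i
  simp [affPt_apply, AffineMap.lineMap_apply]
  ring

theorem lineMap_eq_affPt_snd (a b c : Plane) (s : ℝ) :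
    AffineMap.lineMap a c s = affPt a b c (0, s) := by
  ext i
  simp [affPt_apply, AffineMap.lineMap_apply]
  ring

theorem lineMap_eq_affPt_hyp (a b c : Plane) (s : ℝ) :
    AffineMap.lineMap b c s = affPt a b c (1 - s, s) := by
  ext i
  simp [affPt_apply, AffineMap.lineMap_apply]
  ring

theorem polyFun_bary_eq_zero {a b c : Plane} (h : jac a b c ≠ 0) {x : Plane}
    (hx : x ∈ hull {a, b}) : polyFun (bary a b c) x = 0 := by
  rw [hull_pair] at hx
  obtain ⟨s, -, rfl⟩ := hx
  rw [lineMap_eq_affPt a b c, polyFun_bary_affPt h]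

theorem polyFun_bary_snd_eq_zero {a b c : Plane} (h : jac a b c ≠ 0) {x : Plane}
    (hx : x ∈ hull {a, c}) : polyFun (bary a c b) x = 0 := by
  rw [hull_pair] at hx
  obtain ⟨s, -, rfl⟩ := hx
  rw [lineMap_eq_affPt_snd a b c, polyFun_bary_affPt_fst h]

theorem polyFun_bary₀_eq_zero {a b c : Plane} (h : jac a b c ≠ 0) {x : Plane}
    (hx : x ∈ hull {b, c}) : polyFun (bary₀ a b c) x = 0 := by
  rw [hull_pair] at hx
  obtain ⟨s, -, rfl⟩ := hx
  rw [lineMap_eq_affPt_hyp a b c, polyFun_bary₀_affPt h]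
  simp

/-- The pullback of a polynomial to the reference triangle. -/
noncomputable def pullback (a b c : Plane) (p : MvPolynomial (Fin 2) ℝ) :
    MvPolynomial (Fin 2) ℝ :=
  MvPolynomial.aeval (fun i => MvPolynomial.C (a i) +
    MvPolynomial.C (b i - a i) * MvPolynomial.X 0 +
    MvPolynomial.C (c i - a i) * MvPolynomial.X 1) p

theorem pairEval_pullback (a b c : Plane) (p : MvPolynomial (Fin 2) ℝ) (x : ℝ × ℝ) :
    pairEval (pullback a b c p) x = polyFun p (affPt a b c x) := by
  simp only [pairEval, LinearMap.coe_mk, AddHom.coe_mk, pullback, polyFun, MvPolynomial.aeval_def,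
    MvPolynomial.algebraMap_eq, MvPolynomial.eval_eval₂]
  rw [MvPolynomial.eval₂_eq', MvPolynomial.eval_eq']
  simp [affPt_apply, mul_comm]

theorem totalDegree_pullback_le (a b c : Plane) {p : MvPolynomial (Fin 2) ℝ} {m : ℕ}
    (hp : p.totalDegree ≤ m) : (pullback a b c p).totalDegree ≤ m := by
  refine totalDegree_aeval_le hp fun i => ?_
  refine (MvPolynomial.totalDegree_add _ _).trans (max_le
    ((MvPolynomial.totalDegree_add _ _).trans (max_le (by simp) ?_)) ?_)
  · exact totalDegree_C_mul_le (by simp) _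
  · exact totalDegree_C_mul_le (by simp) _

/-- The restriction of a polynomial to the line through `a` and `b`. -/
noncomputable def restrictLine (a b : Plane) (p : MvPolynomial (Fin 2) ℝ) : Polynomial ℝ :=
  MvPolynomial.aeval (fun i => Polynomial.C (b i - a i) * Polynomial.X + Polynomial.C (a i)) p

theorem eval_restrictLine (a b : Plane) (p : MvPolynomial (Fin 2) ℝ) (s : ℝ) :
    (restrictLine a b p).eval s = polyFun p (AffineMap.lineMap a b s) := by
  simp only [restrictLine, polyFun, MvPolynomial.aeval_def]
  rw [MvPolynomial.eval₂_eq', MvPolynomial.eval_eq', Polynomial.eval_finsetSum]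
  simp [AffineMap.lineMap_apply, mul_comm]

theorem natDegree_restrictLine_le (a b : Plane) {p : MvPolynomial (Fin 2) ℝ} {m : ℕ}
    (hp : p.totalDegree ≤ m) : (restrictLine a b p).natDegree ≤ m := by
  unfold restrictLine
  exact (MvPolynomial.aeval_natDegree_le p hp _
    (fun i => Polynomial.natDegree_linear_le)).trans_eq (mul_one m)

/-! ### Estimates on a triangle -/

/-- The cubic bubble function of a triangle. -/
noncomputable def bubble (a b c : Plane) : MvPolynomial (Fin 2) ℝ :=
  bary₀ a b c * bary a c b * bary a b c

theorem totalDegree_bubble_le (a b c : Plane) : (bubble a b c).totalDegree ≤ 3 :=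
  totalDegree_mul_le' (totalDegree_mul_le' (totalDegree_bary₀_le _ _ _)
    (totalDegree_bary_le _ _ _)) (totalDegree_bary_le _ _ _)

/-- Both sides scale with the same factor `|jac|`, so the reference constant works on every
triangle. The second bound holds because the bubble takes values in `[0, 1]`. -/
theorem exists_bubble_bound (m : ℕ) : ∃ C : ℝ, 0 < C ∧ ∀ a b c : Plane, jac a b c ≠ 0 →
    ∀ p : MvPolynomial (Fin 2) ℝ, p.totalDegree ≤ m →
      triInt {a, b, c} (p * p) ≤ C * triInt {a, b, c} (p * (bubble a b c * p)) ∧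
      triInt {a, b, c} (bubble a b c * p * (bubble a b c * p)) ≤ triInt {a, b, c} (p * p) := by
  obtain ⟨C, hC, H⟩ := exists_ref_bubble_bound m
  refine ⟨C, hC, fun a b c h p hp => ?_⟩
  have e := H _ (totalDegree_pullback_le a b c hp)
  have hb : ∀ x, polyFun (bubble a b c) (affPt a b c x) = (1 - x.1 - x.2) * x.1 * x.2 := fun x => by
    simp only [bubble, polyFun_mul, polyFun_bary₀_affPt h, polyFun_bary_affPt_fst h,
      polyFun_bary_affPt h]
  have hp' : Continuous fun x => polyFun p (affPt a b c x) :=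
    (continuous_polyFun p).comp (continuous_affPt a b c)
  simp only [pairEval_pullback] at e
  simp only [triInt_eq h, polyFun_mul, hb]
  constructor
  · have := mul_le_mul_of_nonneg_left e (abs_nonneg (jac a b c))
    refine this.trans_eq ?_
    rw [mul_left_comm]
    congr 3
    funext x
    ring
  · refine mul_le_mul_of_nonneg_left (setIntegral_mono_on
      (integrableOn_refTriangle (by fun_prop)) (integrableOn_refTriangle (by fun_prop))
      isCompact_refTriangle.measurableSet fun x hx => ?_) (abs_nonneg _)
    obtain ⟨h1, h2, h3⟩ := hx
    have h0 : 0 ≤ (1 - x.1 - x.2) * x.1 * x.2 := mul_nonneg (mul_nonneg (by linarith) h1) h2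
    have h4 : (1 - x.1 - x.2) * x.1 ≤ 1 := mul_le_one₀ (by linarith) h1 (by linarith)
    have h5 : (1 - x.1 - x.2) * x.1 * x.2 ≤ 1 := mul_le_one₀ h4 h2 (by linarith)
    have h6 : ((1 - x.1 - x.2) * x.1 * x.2) * ((1 - x.1 - x.2) * x.1 * x.2) ≤ 1 :=
      mul_le_one₀ h5 h0 h5
    nlinarith [mul_le_mul_of_nonneg_right h6 (mul_self_nonneg (polyFun p (affPt a b c x)))]

/-- The scaled trace inequality: the edge integral carries the factor `dist a b`, the triangle
integral the factor `|jac|`. Clearing these leaves the reference inequality. -/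
theorem exists_trace_bound (m : ℕ) : ∃ C : ℝ, 0 < C ∧ ∀ a b c : Plane, jac a b c ≠ 0 →
    ∀ p : MvPolynomial (Fin 2) ℝ, p.totalDegree ≤ m →
      |jac a b c| * edgeInt a b (p * p) ≤ C * dist a b * triInt {a, b, c} (p * p) := by
  obtain ⟨C, hC, H⟩ := exists_ref_trace_bound m
  refine ⟨C, hC, fun a b c h p hp => ?_⟩
  have e := H _ (totalDegree_pullback_le a b c hp)
  simp only [pairEval_pullback] at e
  simp only [triInt_eq h, edgeInt_eq (ne_of_jac_ne_zero h), polyFun_mul, lineMap_eq_affPt a b c]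
  have := mul_le_mul_of_nonneg_left e (mul_nonneg (abs_nonneg (jac a b c)) (dist_nonneg (x := a)
    (y := b)))
  linarith

/-- The residual on an edge is controlled by the residual inside of the triangle. -/
theorem exists_edge_bound (m : ℕ) : ∃ C : ℝ, 0 < C ∧ ∀ (a b c : Plane) (d : ℝ), jac a b c ≠ 0 →
    0 < d → |jac a b c| ≤ d * dist a b →
    ∀ r g : MvPolynomial (Fin 2) ℝ, g.totalDegree ≤ m →
    (∀ φ : MvPolynomial (Fin 2) ℝ, φ.totalDegree ≤ m + 2 →
      (∀ x ∈ hull {b, c}, polyFun φ x = 0) → (∀ x ∈ hull {a, c}, polyFun φ x = 0) →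
      triInt {a, b, c} (r * φ) = edgeInt a b (g * φ)) →
    edgeInt a b (g * g) ≤ C * d * triInt {a, b, c} (r * r) := by
  obtain ⟨C, hC, H⟩ := exists_ref_edge_bound m
  refine ⟨C ^ 3, by positivity, fun a b c d h hd hJ r g hg hφ => ?_⟩
  obtain ⟨H1, H2⟩ := H _ (natDegree_restrictLine_le a b hg)
  set P := restrictLine a b g with hP
  -- The restriction of `g` to the edge, extended constantly along the direction of `ac` and
  -- multiplied by the barycentric coordinates of `a` and `b`. The factors vanish on `bc` and on
  -- `ac`, respectively.
  set φ := bary₀ a b c * bary a c b * Polynomial.aeval (bary a c b) P with hφdef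
  have hne := ne_of_jac_ne_zero h
  have hφx : ∀ x, polyFun φ (affPt a b c x) = (1 - x.1 - x.2) * x.1 * P.eval x.1 := fun x => by
    simp only [hφdef, polyFun_mul, polyFun_aeval, polyFun_bary₀_affPt h, polyFun_bary_affPt_fst h]
  have hdeg : φ.totalDegree ≤ m + 2 := by
    rw [add_comm]
    exact totalDegree_mul_le' (totalDegree_mul_le' (totalDegree_bary₀_le _ _ _)
      (totalDegree_bary_le _ _ _)) (totalDegree_polynomial_aeval_le
      (natDegree_restrictLine_le a b hg) (totalDegree_bary_le _ _ _))
  have key := hφ φ hdeg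
    (fun x hx => by simp [hφdef, polyFun_bary₀_eq_zero h hx])
    (fun x hx => by simp [hφdef, polyFun_bary_snd_eq_zero h hx])
  have hgg : edgeInt a b (g * g) = dist a b * ∫ s in (0 : ℝ)..1, P.eval s * P.eval s := by
    simp only [edgeInt_eq hne, polyFun_mul, hP, eval_restrictLine]
  have hgφ : edgeInt a b (g * φ) =
      dist a b * ∫ s in (0 : ℝ)..1, ((1 - s) * s) * (P.eval s * P.eval s) := by
    simp only [edgeInt_eq hne, polyFun_mul]
    congr 2
    funext s
    rw [← eval_restrictLine, lineMap_eq_affPt a b c, hφx, ← hP]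
    ring
  have hcont : Continuous fun x : ℝ × ℝ => P.eval x.1 := P.continuous.comp continuous_fst
  have hφφ : triInt {a, b, c} (φ * φ) ≤ d * C * edgeInt a b (g * g) := by
    have h1 : ∫ x in refTriangle, polyFun φ (affPt a b c x) * polyFun φ (affPt a b c x) ≤
        ∫ x in refTriangle, P.eval x.1 * P.eval x.1 := by
      simp only [hφx]
      refine setIntegral_mono_on (integrableOn_refTriangle (by fun_prop))
        (integrableOn_refTriangle (by fun_prop)) isCompact_refTriangle.measurableSet
        fun x hx => ?_
      obtain ⟨h1, h2, h3⟩ := hx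
      have h0 : 0 ≤ (1 - x.1 - x.2) * x.1 := mul_nonneg (by linarith) h1
      have h4 : (1 - x.1 - x.2) * x.1 ≤ 1 := mul_le_one₀ (by linarith) h1 (by linarith)
      have h6 : ((1 - x.1 - x.2) * x.1) * ((1 - x.1 - x.2) * x.1) ≤ 1 := mul_le_one₀ h4 h0 h4
      nlinarith [mul_le_mul_of_nonneg_right h6 (mul_self_nonneg (P.eval x.1))]
    have h2 : 0 ≤ ∫ s in (0 : ℝ)..1, P.eval s * P.eval s :=
      intervalIntegral.integral_nonneg zero_le_one fun s _ => mul_self_nonneg _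
    simp only [triInt_eq h, polyFun_mul]
    rw [hgg]
    calc |jac a b c| * ∫ x in refTriangle,
          polyFun φ (affPt a b c x) * polyFun φ (affPt a b c x)
        ≤ |jac a b c| * (C * ∫ s in (0 : ℝ)..1, P.eval s * P.eval s) :=
          mul_le_mul_of_nonneg_left (h1.trans H1) (abs_nonneg _)
      _ ≤ d * dist a b * (C * ∫ s in (0 : ℝ)..1, P.eval s * P.eval s) :=
          mul_le_mul_of_nonneg_right hJ (mul_nonneg hC.le h2)
      _ = d * C * (dist a b * ∫ s in (0 : ℝ)..1, P.eval s * P.eval s) := by ring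
  have h1 : edgeInt a b (g * g) ≤ C * triInt {a, b, c} (r * φ) := by
    rw [key, hgg, hgφ, mul_left_comm]
    exact mul_le_mul_of_nonneg_left H2 dist_nonneg
  -- With this Young parameter the term in `φ * φ` becomes, after multiplication by `C`, at most one
  -- copy of `edgeInt a b (g * g)`. It is absorbed by the two copies on the left, and `C ^ 3 * d`
  -- remains.
  have hA : 0 < d * C ^ 2 := by positivity
  have h2 := two_mul_le_of_sq_nonneg (triInt_sq_nonneg {a, b, c}) r φ hA
  have h3 : (d * C ^ 2)⁻¹ * triInt {a, b, c} (φ * φ) ≤ C⁻¹ * edgeInt a b (g * g) := by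
    have := mul_le_mul_of_nonneg_left hφφ (inv_pos.2 hA).le
    refine this.trans_eq ?_
    field_simp
  have h4 : C * (2 * triInt {a, b, c} (r * φ)) ≤
      C * (d * C ^ 2 * triInt {a, b, c} (r * r) + C⁻¹ * edgeInt a b (g * g)) :=
    mul_le_mul_of_nonneg_left (by linarith) hC.le
  rw [mul_add, mul_inv_cancel_left₀ hC.ne'] at h4
  linarith

/-- Upper bound on the boundary term for one edge. -/
theorem edge_term_le {C δ d a' : ℝ} {a b c : Plane} (hδ : 0 < δ) (hd : 0 < d)
    (ha' : 0 < a') (h : jac a b c ≠ 0) (hJ : 2 * δ * d * dist a b ≤ |jac a b c|)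
    {p : MvPolynomial (Fin 2) ℝ}
    (htr : |jac a b c| * edgeInt a b (p * p) ≤ C * dist a b * triInt {a, b, c} (p * p))
    (g : MvPolynomial (Fin 2) ℝ) :
    2 * edgeInt a b (g * p) ≤
      a' * (d⁻¹ * edgeInt a b (g * g)) + C / (2 * δ * a') * triInt {a, b, c} (p * p) := by
  -- The weight `a' / d` produces the factor `d⁻¹` of the mesh norm; its inverse `d / a'` is
  -- compensated by the trace inequality.
  have h1 := two_mul_le_of_sq_nonneg (edgeInt_sq_nonneg a b) g p (A := a' * d⁻¹) (by positivity)
  have hdist : 0 < dist a b := dist_pos.2 (ne_of_jac_ne_zero h)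
  have h2 : 2 * δ * d * edgeInt a b (p * p) ≤ C * triInt {a, b, c} (p * p) := by
    have h3 := (mul_le_mul_of_nonneg_right hJ (edgeInt_sq_nonneg a b p)).trans htr
    refine le_of_mul_le_mul_left ?_ hdist
    linarith
  have h4 : (a' * d⁻¹)⁻¹ * edgeInt a b (p * p) ≤ C / (2 * δ * a') * triInt {a, b, c} (p * p) := by
    have := mul_le_mul_of_nonneg_left h2 (by positivity : 0 ≤ (2 * δ * a')⁻¹)
    refine le_trans (le_of_eq ?_) (this.trans_eq ?_)
    · field_simp
    · ring
  linarith

/-- Equivalence of the two local norms for the solution `ψ` of the local problem with interior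
datum `G` and boundary data `ga`, `gb`, `gc`. -/
theorem exists_local_bounds (k : ℕ) {δ : ℝ} (hδ : 0 < δ) : ∃ C : ℝ, 0 < C ∧
    ∀ (a b c : Plane) (d : ℝ), jac a b c ≠ 0 → 0 < d →
    (2 * δ * d * dist a b ≤ |jac a b c| ∧ |jac a b c| ≤ d * dist a b) →
    (2 * δ * d * dist b c ≤ |jac a b c| ∧ |jac a b c| ≤ d * dist b c) →
    (2 * δ * d * dist a c ≤ |jac a b c| ∧ |jac a b c| ≤ d * dist a c) →
    ∀ ψ G ga gb gc : MvPolynomial (Fin 2) ℝ, ψ.totalDegree ≤ k + 3 → G.totalDegree ≤ k →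
    ga.totalDegree ≤ k + 1 → gb.totalDegree ≤ k + 1 → gc.totalDegree ≤ k + 1 →
    (∀ φ : MvPolynomial (Fin 2) ℝ, φ.totalDegree ≤ k + 3 →
      triInt {a, b, c} (ψ * φ) = triInt {a, b, c} (G * φ) + (edgeInt b c (ga * φ) +
        edgeInt a c (gb * φ) + edgeInt a b (gc * φ))) →
    triInt {a, b, c} (ψ * ψ) ≤ C * (triInt {a, b, c} (G * G) + d⁻¹ * (edgeInt b c (ga * ga) +
        edgeInt a c (gb * gb) + edgeInt a b (gc * gc))) ∧
    triInt {a, b, c} (G * G) + d⁻¹ * (edgeInt b c (ga * ga) +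
        edgeInt a c (gb * gb) + edgeInt a b (gc * gc)) ≤ C * triInt {a, b, c} (ψ * ψ) := by
  obtain ⟨B, hB, HB⟩ := exists_bubble_bound k
  obtain ⟨E, hE, HE⟩ := exists_edge_bound (k + 1)
  obtain ⟨R, hR, HR⟩ := exists_trace_bound (k + 3)
  -- With the Young parameter `3R/δ` each of the three edges contributes `1/6` of `‖ψ‖²`. Together
  -- with the `1/2` from the interior term this is one of the two copies of `‖ψ‖²` on the left.
  have hRδ : 0 < 3 * R / δ := by positivity
  -- A sum that dominates the constants of both directions: `2` and `3R/δ` for the upper bound, the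
  -- parenthesis for the lower one.
  refine ⟨4 + 2 * (3 * R / δ) + (B ^ 2 + 3 * E * (2 + 2 * B ^ 2)), by positivity,
    fun a b c d h hd hab hbc hac ψ G ga gb gc hψ hG hga hgb hgc hyp => ?_⟩
  have hbca : jac b c a ≠ 0 := by rwa [jac_rotate]
  have hacb : jac a c b ≠ 0 := by rw [jac_swap]; exact neg_ne_zero.2 h
  have jbca : |jac b c a| = |jac a b c| := by rw [jac_rotate]
  have jacb : |jac a c b| = |jac a b c| := by rw [jac_swap, abs_neg]
  have pbca : ({b, c, a} : Finset Plane) = {a, b, c} := by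
    rw [Finset.pair_comm c a, Finset.insert_comm]
  have pacb : ({a, c, b} : Finset Plane) = {a, b, c} := by rw [Finset.pair_comm]
  have Tn : ∀ p, 0 ≤ triInt {a, b, c} (p * p) := triInt_sq_nonneg _
  have Nn : 0 ≤ triInt {a, b, c} (G * G) + d⁻¹ * (edgeInt b c (ga * ga) +
        edgeInt a c (gb * gb) + edgeInt a b (gc * gc)) :=
    add_nonneg (Tn G) (mul_nonneg (inv_pos.2 hd).le (add_nonneg (add_nonneg
      (edgeInt_sq_nonneg _ _ _) (edgeInt_sq_nonneg _ _ _)) (edgeInt_sq_nonneg _ _ _)))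
  constructor
  · have t1 := HR a b c h ψ hψ
    have t2 := HR b c a hbca ψ hψ
    have t3 := HR a c b hacb ψ hψ
    have e1 := edge_term_le hδ hd hRδ h hab.1 t1 gc
    have e2 := edge_term_le hδ hd hRδ hbca (by rw [jbca]; exact hbc.1) t2 ga
    have e3 := edge_term_le hδ hd hRδ hacb (by rw [jacb]; exact hac.1) t3 gb
    have e4 := two_mul_le_of_sq_nonneg (triInt_sq_nonneg {a, b, c}) G ψ (A := 2) (by norm_num)
    have e5 := hyp ψ hψ
    have e6 : R / (2 * δ * (3 * R / δ)) = 1 / 6 := by field_simp; norm_num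
    rw [pbca] at e2
    rw [pacb] at e3
    rw [e6] at e1 e2 e3
    set N := d⁻¹ * (edgeInt b c (ga * ga) + edgeInt a c (gb * gb) + edgeInt a b (gc * gc)) with hN
    have hN0 : 0 ≤ N := mul_nonneg (inv_pos.2 hd).le (add_nonneg (add_nonneg
      (edgeInt_sq_nonneg _ _ _) (edgeInt_sq_nonneg _ _ _)) (edgeInt_sq_nonneg _ _ _))
    have e7 : triInt {a, b, c} (ψ * ψ) ≤ 2 * triInt {a, b, c} (G * G) + 3 * R / δ * N := by
      have : 3 * R / δ * N = 3 * R / δ * (d⁻¹ * edgeInt b c (ga * ga)) +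
        3 * R / δ * (d⁻¹ * edgeInt a c (gb * gb)) + 3 * R / δ * (d⁻¹ * edgeInt a b (gc * gc)) := by
        rw [hN]; ring
      linarith
    have hW : 0 ≤ B ^ 2 + 3 * E * (2 + 2 * B ^ 2) := by positivity
    have g1 := mul_nonneg hW Nn
    have g2 := mul_nonneg hRδ.le (Tn G)
    have g3 := mul_nonneg hRδ.le hN0
    have g4 := Tn G
    linarith
  · have hBest : triInt {a, b, c} (G * G) ≤ B ^ 2 * triInt {a, b, c} (ψ * ψ) := by
      obtain ⟨b1, b2⟩ := HB a b c h G hG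
      have hz : ∀ g, edgeInt b c (g * (bubble a b c * G)) = 0 ∧
          edgeInt a c (g * (bubble a b c * G)) = 0 ∧ edgeInt a b (g * (bubble a b c * G)) = 0 := by
        intro g
        refine ⟨edgeInt_eq_zero fun x hx => ?_, edgeInt_eq_zero fun x hx => ?_,
          edgeInt_eq_zero fun x hx => ?_⟩
        · simp [bubble, polyFun_bary₀_eq_zero h hx]
        · simp [bubble, polyFun_bary_snd_eq_zero h hx]
        · simp [bubble, polyFun_bary_eq_zero h hx]
      have b3 := hyp (bubble a b c * G) (by
        rw [add_comm]; exact totalDegree_mul_le' (totalDegree_bubble_le a b c) hG)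
      rw [(hz ga).1, (hz gb).2.1, (hz gc).2.2, add_zero, add_zero, add_zero] at b3
      -- Since `‖G‖² ≤ B (ψ, bG)`, the parameter `B` leaves one copy of `‖G‖²` to absorb and the
      -- constant `B ^ 2`.
      have b4 := two_mul_le_of_sq_nonneg (triInt_sq_nonneg {a, b, c}) ψ (bubble a b c * G) hB
      have b5 : B⁻¹ * triInt {a, b, c} (bubble a b c * G * (bubble a b c * G)) ≤
          B⁻¹ * triInt {a, b, c} (G * G) := mul_le_mul_of_nonneg_left b2 (inv_pos.2 hB).le
      have b6 : B * (2 * triInt {a, b, c} (ψ * (bubble a b c * G))) ≤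
          B * (B * triInt {a, b, c} (ψ * ψ) + B⁻¹ * triInt {a, b, c} (G * G)) :=
        mul_le_mul_of_nonneg_left (by linarith) hB.le
      rw [mul_add, mul_inv_cancel_left₀ hB.ne', b3] at b6
      linarith
    -- The residual `ψ - G` sees only boundary data, which is the hypothesis of `exists_edge_bound`
    -- with `m = k + 1`; that bound is used for all three labellings of the triangle.
    set r := ψ - G with hr
    have hyp' : ∀ φ : MvPolynomial (Fin 2) ℝ, φ.totalDegree ≤ k + 1 + 2 →
        triInt {a, b, c} (r * φ) =
          edgeInt b c (ga * φ) + edgeInt a c (gb * φ) + edgeInt a b (gc * φ) := by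
      intro φ hφ
      rw [hr, sub_mul, map_sub, hyp φ hφ]
      ring
    have hz : ∀ {x y : Plane} (g : MvPolynomial (Fin 2) ℝ) {φ : MvPolynomial (Fin 2) ℝ},
        (∀ z ∈ hull {x, y}, polyFun φ z = 0) → edgeInt x y (g * φ) = 0 := fun g φ hφ =>
      edgeInt_eq_zero fun z hz => by rw [polyFun_mul, hφ z hz, mul_zero]
    have e1 := HE a b c d h hd hab.2 r gc hgc fun φ hφ z1 z2 => by
      rw [hyp' φ hφ, hz ga z1, hz gb z2]; ring
    have e2 := HE b c a d hbca hd (by rw [jbca]; exact hbc.2) r ga hga fun φ hφ z1 z2 => by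
      rw [Finset.pair_comm] at z1 z2
      rw [pbca, hyp' φ hφ, hz gb z1, hz gc z2]; ring
    have e3 := HE a c b d hacb hd (by rw [jacb]; exact hac.2) r gb hgb fun φ hφ z1 z2 => by
      rw [Finset.pair_comm] at z1
      rw [pacb, hyp' φ hφ, hz ga z1, hz gc z2]; ring
    rw [pbca] at e2
    rw [pacb] at e3
    have hrr : triInt {a, b, c} (r * r) ≤ (2 + 2 * B ^ 2) * triInt {a, b, c} (ψ * ψ) := by
      -- Parallelogram law: `‖ψ - G‖² = 2‖ψ‖² + 2‖G‖² - ‖ψ + G‖²`.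
      have s1 := Tn (ψ + G)
      have s2 : (ψ + G) * (ψ + G) = (2 : ℝ) • (ψ * ψ) + (2 : ℝ) • (G * G) - r * r := by
        simp only [hr, MvPolynomial.smul_eq_C_mul, map_ofNat]; ring
      rw [s2, map_sub, map_add, map_smul, map_smul, smul_eq_mul, smul_eq_mul] at s1
      linarith
    have e4 : d⁻¹ * (edgeInt b c (ga * ga) + edgeInt a c (gb * gb) + edgeInt a b (gc * gc)) ≤
        3 * E * triInt {a, b, c} (r * r) := by
      have : edgeInt b c (ga * ga) + edgeInt a c (gb * gb) + edgeInt a b (gc * gc) ≤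
        3 * (E * d * triInt {a, b, c} (r * r)) := by linarith
      refine (mul_le_mul_of_nonneg_left this (inv_pos.2 hd).le).trans_eq ?_
      field_simp
    have e5 := mul_le_mul_of_nonneg_left hrr (by positivity : 0 ≤ 3 * E)
    have e6 := mul_nonneg (by positivity : 0 ≤ 4 + 2 * (3 * R / δ)) (Tn ψ)
    linarith

/-! ### Green's formula on a triangle -/

/-- The derivative of a polynomial in the direction `n`. -/
noncomputable def dirDeriv (n : Plane) (p : MvPolynomial (Fin 2) ℝ) : MvPolynomial (Fin 2) ℝ :=
  ∑ i, MvPolynomial.C (n i) * MvPolynomial.pderiv i p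

theorem polyFun_dirDeriv (n : Plane) (p : MvPolynomial (Fin 2) ℝ) (x : Plane) :
    polyFun (dirDeriv n p) x = ⟪∇ (polyFun p) x, n⟫ := by
  rw [inner_gradient_polyFun, dirDeriv]
  simp only [Fin.sum_univ_two, polyFun_add, polyFun_mul, polyFun_C]
  ring

theorem dirDeriv_smul (r : ℝ) (n : Plane) (p : MvPolynomial (Fin 2) ℝ) :
    dirDeriv (r • n) p = MvPolynomial.C r * dirDeriv n p := by
  simp [dirDeriv, mul_add, mul_assoc]

theorem totalDegree_dirDeriv_le (n : Plane) {p : MvPolynomial (Fin 2) ℝ} {m : ℕ}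
    (hp : p.totalDegree ≤ m + 1) : (dirDeriv n p).totalDegree ≤ m :=
  MvPolynomial.totalDegree_finsetSum_le fun i _ =>
    totalDegree_C_mul_le (totalDegree_pderiv_le hp i) _

/-- The inner product of the gradients of two polynomials. -/
noncomputable def gradInner (p q : MvPolynomial (Fin 2) ℝ) : MvPolynomial (Fin 2) ℝ :=
  ∑ i, MvPolynomial.pderiv i p * MvPolynomial.pderiv i q

theorem polyFun_gradInner (p q : MvPolynomial (Fin 2) ℝ) (x : Plane) :
    polyFun (gradInner p q) x = ⟪∇ (polyFun p) x, ∇ (polyFun q) x⟫ := by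
  rw [inner_gradient_polyFun]
  simp only [gradInner, gradient_polyFun_apply, Fin.sum_univ_two, polyFun_add, polyFun_mul]

/-- The divergence theorem for the fields `φ ∂ᵢp eᵢ`, summed over `i`, with the product rule. -/
theorem green_triangle {a b c na nb nc : Plane} (h : jac a b c ≠ 0)
    (hna : ‖na‖ = 1) (hnb : ‖nb‖ = 1) (hnc : ‖nc‖ = 1)
    (oa : ⟪na, b - c⟫ = 0) (ob : ⟪nb, a - c⟫ = 0) (oc : ⟪nc, a - b⟫ = 0)
    (pa : 0 < ⟪na, b - a⟫) (pb : 0 < ⟪nb, c - b⟫) (pc : 0 < ⟪nc, a - c⟫)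
    (p φ : MvPolynomial (Fin 2) ℝ) :
    triInt {a, b, c} (polyLaplacian p * φ) + triInt {a, b, c} (gradInner p φ) =
      edgeInt b c (dirDeriv na p * φ) + edgeInt a c (dirDeriv nb p * φ) +
        edgeInt a b (dirDeriv nc p * φ) := by
  have key : ∀ i : Fin 2, triInt {a, b, c} (MvPolynomial.pderiv i (φ * MvPolynomial.pderiv i p)) =
      edgeInt b c (MvPolynomial.C (na i) * (φ * MvPolynomial.pderiv i p)) +
      edgeInt a c (MvPolynomial.C (nb i) * (φ * MvPolynomial.pderiv i p)) +
      edgeInt a b (MvPolynomial.C (nc i) * (φ * MvPolynomial.pderiv i p)) := by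
    intro i
    have := setIntegral_hull_inner_gradient h hna hnb hnc oa ob oc pa pb pc
      (φ * MvPolynomial.pderiv i p) (EuclideanSpace.single i 1)
    simp only [EuclideanSpace.inner_single_right, gradient_polyFun_apply] at this
    simp only [← MvPolynomial.smul_eq_C_mul, map_smul, smul_eq_mul]
    simpa [triInt_apply, edgeInt_apply] using this
  have e1 : polyLaplacian p * φ + gradInner p φ =
      ∑ i, MvPolynomial.pderiv i (φ * MvPolynomial.pderiv i p) := by
    simp only [polyLaplacian, gradInner, Fin.sum_univ_two, Derivation.leibniz, smul_eq_mul]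
    ring
  have e2 : ∀ n : Plane, dirDeriv n p * φ =
      ∑ i, MvPolynomial.C (n i) * (φ * MvPolynomial.pderiv i p) := by
    intro n
    simp only [dirDeriv, Fin.sum_univ_two]
    ring
  rw [← map_add, e1, e2, e2, e2]
  simp only [map_sum, key, Finset.sum_add_distrib]

/-! ### Geometry of triangles containing a disc -/

/-- By Lagrange's identity the determinant is at most the product of the two side lengths. -/
theorem abs_jac_le {a b c : Plane} {d : ℝ} (hc : dist a c ≤ d) :
    |jac a b c| ≤ d * dist a b := by
  have h1 : |jac a b c| ≤ dist a c * dist a b := by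
    refine abs_le_of_sq_le_sq ?_ (by positivity)
    rw [mul_pow, dist_eq_norm, dist_eq_norm, norm_sq_plane, norm_sq_plane]
    simp only [jac, PiLp.sub_apply]
    nlinarith [sq_nonneg ((a 0 - c 0) * (a 0 - b 0) + (a 1 - c 1) * (a 1 - b 1))]
  exact h1.trans (mul_le_mul_of_nonneg_right hc dist_nonneg)

/-- The height over `ab` is at least the width `2ρ` of the disc. In formulas, `jac a b x` is affine
in `x` and stays between `0` and `jac a b c` on the triangle, while it changes by `2 ρ dist a b`
across the disc. -/
theorem le_abs_jac_of_closedBall_subset {a b c x₀ : Plane} {ρ : ℝ} (hρ : 0 ≤ ρ)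
    (h : jac a b c ≠ 0) (hB : Metric.closedBall x₀ ρ ⊆ hull {a, b, c}) :
    2 * ρ * dist a b ≤ |jac a b c| := by
  have hcoord : ∀ x ∈ hull {a, b, c}, ∃ t : ℝ, 0 ≤ t ∧ t ≤ 1 ∧ jac a b x = t * jac a b c := by
    intro x hx
    rw [hull_eq_image] at hx
    obtain ⟨p, ⟨h1, h2, h3⟩, rfl⟩ := hx
    refine ⟨p.2, h2, by linarith, ?_⟩
    simp only [jac, affPt_apply]
    ring
  have hd : 0 < dist a b := dist_pos.2 (ne_of_jac_ne_zero h)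
  have hd2 : dist a b ^ 2 = (b 0 - a 0) ^ 2 + (b 1 - a 1) ^ 2 := by
    rw [dist_eq_norm, norm_sq_plane]; simp only [PiLp.sub_apply]; ring
  -- `b - a` rotated by a quarter turn; the antipodal points `x₀ ± (ρ / dist a b) • y` of the disc
  -- are compared.
  set y : Plane := !₂[-(b 1 - a 1), b 0 - a 0] with hy
  have hny : ‖y‖ = dist a b := by
    rw [← sq_eq_sq₀ (norm_nonneg _) hd.le, norm_sq_plane, hd2]
    simp [hy]
    ring
  have hnorm : ‖(ρ / dist a b) • y‖ = ρ := by
    rw [norm_smul, hny, Real.norm_of_nonneg (by positivity), div_mul_cancel₀ _ hd.ne']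
  obtain ⟨t, ht0, ht1, ht⟩ := hcoord (x₀ + (ρ / dist a b) • y)
    (hB (by simp [hnorm]))
  obtain ⟨t', ht0', ht1', ht'⟩ := hcoord (x₀ - (ρ / dist a b) • y)
    (hB (by rw [Metric.mem_closedBall, dist_eq_norm, sub_sub_cancel_left, norm_neg, hnorm]))
  have e : jac a b (x₀ + (ρ / dist a b) • y) - jac a b (x₀ - (ρ / dist a b) • y) =
      2 * ρ * dist a b := by
    have e1 : jac a b (x₀ + (ρ / dist a b) • y) - jac a b (x₀ - (ρ / dist a b) • y) =
        2 * (ρ / dist a b) * ((b 0 - a 0) ^ 2 + (b 1 - a 1) ^ 2) := by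
      simp [jac, hy]; ring
    rw [e1, ← hd2]
    field_simp
  rw [← e, ht, ht', ← sub_mul]
  refine (le_abs_self _).trans ?_
  rw [abs_mul]
  exact mul_le_of_le_one_left (abs_nonneg _) (abs_le.2 ⟨by linarith, by linarith⟩)

theorem unit_normal_eq_smul {m n u : Plane} (hm : ‖m‖ = 1) (hn : ‖n‖ = 1) (hu : u ≠ 0)
    (h1 : ⟪m, u⟫ = 0) (h2 : ⟪n, u⟫ = 0) : ⟪m, n⟫ ^ 2 = 1 ∧ n = ⟪m, n⟫ • m := by
  have hm2 := norm_sq_plane m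
  have hn2 := norm_sq_plane n
  rw [hm] at hm2
  rw [hn] at hn2
  simp only [inner_plane] at *
  -- Two vectors orthogonal to the same nonzero vector of the plane are parallel. Then `⟪m, n⟫² = 1`
  -- by Lagrange's identity.
  have hdet : m 0 * n 1 - m 1 * n 0 = 0 := by
    by_contra hne
    apply hu
    have e0 : (m 0 * n 1 - m 1 * n 0) * u 0 = 0 := by linear_combination n 1 * h1 - m 1 * h2
    have e1 : (m 0 * n 1 - m 1 * n 0) * u 1 = 0 := by linear_combination m 0 * h2 - n 0 * h1
    ext i
    fin_cases i
    · exact (mul_eq_zero.1 e0).resolve_left hne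
    · exact (mul_eq_zero.1 e1).resolve_left hne
  constructor
  · linear_combination -(m 0 * n 1 - m 1 * n 0) * hdet - hm2 * (n 0 ^ 2 + n 1 ^ 2) - hn2
  · ext i
    fin_cases i
    · simp
      linear_combination n 0 * hm2 - m 1 * hdet
    · simp
      linear_combination n 1 * hm2 + m 0 * hdet

/-! ### The estimate on one element -/

theorem boundaryIntegral_triangle {K : Finset Plane} {a b c : Plane} (hab : a ≠ b) (hac : a ≠ c)
    (hbc : b ≠ c) (hK : K = {a, b, c}) (ea : K.erase a = {b, c}) (eb : K.erase b = {a, c})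
    (ec : K.erase c = {a, b}) {f : Plane → Plane → ℝ} {pa pb pc : MvPolynomial (Fin 2) ℝ}
    (ha : Set.EqOn (f a) (polyFun pa) (hull {b, c}))
    (hb : Set.EqOn (f b) (polyFun pb) (hull {a, c}))
    (hc : Set.EqOn (f c) (polyFun pc) (hull {a, b})) :
    boundaryIntegral K f = edgeInt b c pa + edgeInt a c pb + edgeInt a b pc := by
  have e : boundaryIntegral K f =
      (∫ x in hull (K.erase a), f a x ∂(Measure.hausdorffMeasure 1)) +
      ((∫ x in hull (K.erase b), f b x ∂(Measure.hausdorffMeasure 1)) +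
      ∫ x in hull (K.erase c), f c x ∂(Measure.hausdorffMeasure 1)) := by
    unfold boundaryIntegral
    -- Only the index set is replaced; `K` has to remain in the summand so that `K.erase z` can be
    -- rewritten by `ea`, `eb`, `ec`.
    conv_lhs => rw [show (K.sum fun z => ∫ x in hull (K.erase z), f z x
      ∂(Measure.hausdorffMeasure 1)) = ({a, b, c} : Finset Plane).sum fun z =>
        ∫ x in hull (K.erase z), f z x ∂(Measure.hausdorffMeasure 1) from by rw [← hK]]
    rw [Finset.sum_insert (by simp [hab, hac]), Finset.sum_pair hbc]
  rw [e, ea, eb, ec, setIntegral_congr_fun (isCompact_hull _).measurableSet ha,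
    setIntegral_congr_fun (isCompact_hull _).measurableSet hb,
    setIntegral_congr_fun (isCompact_hull _).measurableSet hc, add_assoc]
  rfl

/-- Reduction to `exists_local_bounds` with `d = h_K`, `G = Δv₀` and edge data `σ (v_n - ∂v₀/∂n_e)`,
where `σ = n_e ⬝ n = ±1`. The sign disappears in the squares but is needed in the equation for `ψ`.
-/
theorem exists_element_bounds (k : ℕ) {δ : ℝ} (hδ : 0 < δ) : ∃ C : ℝ, 0 < C ∧
    ∀ (K : Finset Plane) (ne : Finset Plane → Plane) (v : (Plane → ℝ) × (Finset Plane → Plane → ℝ)),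
    AffineIndependent ℝ ((↑) : K → Plane) → K.card = 3 →
    (∃ x, Metric.closedBall x (δ * Metric.diam (hull K)) ⊆ hull K) →
    (∀ z ∈ K, ‖ne (K.erase z)‖ = 1 ∧
      ∀ a ∈ K.erase z, ∀ b ∈ K.erase z, ⟪ne (K.erase z), a - b⟫ = 0) →
    IsPolyOn (k + 2) (hull K) v.1 →
    (∀ z ∈ K, IsPolyOn (k + 1) (hull (K.erase z)) (v.2 (K.erase z))) →
    (∫ x in hull K, (polyFun (weakLaplacian ne (k + 3) v K) x) ^ 2) ≤
      C * ((∫ x in hull K, (InnerProductSpace.laplacianWithin v.1 (hull K) x) ^ 2) +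
      (Metric.diam (hull K))⁻¹ * boundaryIntegral K (fun z x =>
        (⟪gradientWithin v.1 (hull K) x, ne (K.erase z)⟫ - v.2 (K.erase z) x) ^ 2)) ∧
    (∫ x in hull K, (InnerProductSpace.laplacianWithin v.1 (hull K) x) ^ 2) +
      (Metric.diam (hull K))⁻¹ * boundaryIntegral K (fun z x =>
        (⟪gradientWithin v.1 (hull K) x, ne (K.erase z)⟫ - v.2 (K.erase z) x) ^ 2) ≤
      C * ∫ x in hull K, (polyFun (weakLaplacian ne (k + 3) v K) x) ^ 2 := by
  obtain ⟨C, hC, H⟩ := exists_local_bounds k hδ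
  refine ⟨C, hC, fun K ne v hind hcard hball hne hv0 hvn => ?_⟩
  have hψ : IsWeakLaplacian ne (k + 3) v K (weakLaplacian ne (k + 3) v K) :=
    -- The chosen polynomial solves the defining equation because a solution exists.
    Classical.epsilon_spec (existsUnique_isWeakLaplacian ne (k + 3) v hind hcard hv0 hvn).exists
  set ψ := weakLaplacian ne (k + 3) v K with hψdef
  obtain ⟨a, b, c, hab, hac, hbc, hK⟩ := Finset.card_eq_three.1 hcard
  have ma : a ∈ K := by simp [hK]
  have mb : b ∈ K := by simp [hK]
  have mc : c ∈ K := by simp [hK]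
  have ea : K.erase a = {b, c} := by
    rw [hK, Finset.erase_insert (by simp [hab, hac])]
  have eb : K.erase b = {a, c} := by
    rw [hK, Finset.insert_comm, Finset.erase_insert (by simp [hab.symm, hbc])]
  have ec : K.erase c = {a, b} := by
    rw [hK, Finset.pair_comm b c, Finset.insert_comm,
      Finset.erase_insert (by simp [hac.symm, hbc.symm])]
  obtain ⟨una, ona, pna⟩ := outwardNormal_spec hind hcard ma
  obtain ⟨unb, onb, pnb⟩ := outwardNormal_spec hind hcard mb
  obtain ⟨unc, onc, pnc⟩ := outwardNormal_spec hind hcard mc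
  set na := outwardNormal K a with hna
  set nb := outwardNormal K b with hnb
  set nc := outwardNormal K c with hnc
  have oa := ona b (by simp [ea]) c (by simp [ea])
  have ob := onb a (by simp [eb]) c (by simp [eb])
  have oc := onc a (by simp [ec]) b (by simp [ec])
  have pa := pna b (by simp [ea])
  have pb := pnb c (by simp [eb])
  have pc := pnc a (by simp [ec])
  have hjac : jac a b c ≠ 0 := by
    have := inner_normal_mul_dist unc oc pc.le
    exact abs_pos.1 (this ▸ mul_pos pc (dist_pos.2 hab))
  obtain ⟨p, hpdeg, hp⟩ := hv0
  obtain ⟨qa, hqa, eqa⟩ := hvn a ma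
  obtain ⟨qb, hqb, eqb⟩ := hvn b mb
  obtain ⟨qc, hqc, eqc⟩ := hvn c mc
  obtain ⟨uma, oma⟩ := hne a ma
  obtain ⟨umb, omb⟩ := hne b mb
  obtain ⟨umc, omc⟩ := hne c mc
  have oma' := oma b (by simp [ea]) c (by simp [ea])
  have omb' := omb a (by simp [eb]) c (by simp [eb])
  have omc' := omc a (by simp [ec]) b (by simp [ec])
  obtain ⟨sa, da⟩ := unit_normal_eq_smul uma una (sub_ne_zero.2 hbc) oma' oa
  obtain ⟨sb, db⟩ := unit_normal_eq_smul umb unb (sub_ne_zero.2 hac) omb' ob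
  obtain ⟨sc, dc⟩ := unit_normal_eq_smul umc unc (sub_ne_zero.2 hab) omc' oc
  set va := ne (K.erase a) with hva
  set vb := ne (K.erase b) with hvb
  set vc := ne (K.erase c) with hvc
  set σa := ⟪va, na⟫ with hσa
  set σb := ⟪vb, nb⟫ with hσb
  set σc := ⟪vc, nc⟫ with hσc
  have hi := interior_hull_nonempty hind hcard
  have hgrad := gradientWithin_eq_of_eqOn hi hp
  have hlap := laplacianWithin_eq_of_eqOn hi hp
  have hsub : ∀ z, hull (K.erase z) ⊆ hull K := fun z =>
    convexHull_mono (Finset.coe_subset.2 (Finset.erase_subset z K))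
  have sbc : hull {b, c} ⊆ hull K := ea ▸ hsub a
  have sac : hull {a, c} ⊆ hull K := eb ▸ hsub b
  have sab : hull {a, b} ⊆ hull K := ec ▸ hsub c
  rw [ea] at eqa
  rw [eb] at eqb
  rw [ec] at eqc
  set ga := MvPolynomial.C σa * (qa - dirDeriv va p) with hga
  set gb := MvPolynomial.C σb * (qb - dirDeriv vb p) with hgb
  set gc := MvPolynomial.C σc * (qc - dirDeriv vc p) with hgc
  have hX : (∫ x in hull K, (polyFun ψ x) ^ 2) = triInt {a, b, c} (ψ * ψ) := by
    simp only [triInt_apply, polyFun_mul, ← hK, pow_two]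
  have hG : (∫ x in hull K, (InnerProductSpace.laplacianWithin v.1 (hull K) x) ^ 2) =
      triInt {a, b, c} (polyLaplacian p * polyLaplacian p) := by
    rw [← hK, triInt_apply]
    refine setIntegral_congr_fun (isCompact_hull K).measurableSet fun x hx => ?_
    simp only [hlap hx, polyFun_mul, pow_two]
  have hBd : boundaryIntegral K (fun z x =>
        (⟪gradientWithin v.1 (hull K) x, ne (K.erase z)⟫ - v.2 (K.erase z) x) ^ 2) =
      edgeInt b c (ga * ga) + edgeInt a c (gb * gb) + edgeInt a b (gc * gc) := by
    refine boundaryIntegral_triangle hab hac hbc hK ea eb ec (fun x hx => ?_) (fun x hx => ?_)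
      (fun x hx => ?_)
    · have e := eqa hx
      rw [← ea] at e
      simp only [hga, polyFun_mul, polyFun_C, polyFun_sub, polyFun_dirDeriv, hgrad (sbc hx), e,
        ← hva]
      linear_combination -(⟪∇ (polyFun p) x, va⟫ - polyFun qa x) ^ 2 * sa
    · have e := eqb hx
      rw [← eb] at e
      simp only [hgb, polyFun_mul, polyFun_C, polyFun_sub, polyFun_dirDeriv, hgrad (sac hx), e,
        ← hvb]
      linear_combination -(⟪∇ (polyFun p) x, vb⟫ - polyFun qb x) ^ 2 * sb
    · have e := eqc hx
      rw [← ec] at e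
      simp only [hgc, polyFun_mul, polyFun_C, polyFun_sub, polyFun_dirDeriv, hgrad (sab hx), e,
        ← hvc]
      linear_combination -(⟪∇ (polyFun p) x, vc⟫ - polyFun qc x) ^ 2 * sc
  rw [hX, hG, hBd]
  have hbdd : Bornology.IsBounded (hull K) := (isCompact_hull K).isBounded
  have hmem : ∀ x ∈ K, x ∈ hull K := fun x hx => subset_convexHull ℝ _ (Finset.mem_coe.2 hx)
  have hdist : ∀ x ∈ K, ∀ y ∈ K, dist x y ≤ Metric.diam (hull K) := fun x hx y hy =>
    Metric.dist_le_diam_of_mem hbdd (hmem x hx) (hmem y hy)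
  have hd : 0 < Metric.diam (hull K) := (dist_pos.2 hab).trans_le (hdist a ma b mb)
  obtain ⟨x₀, hx₀⟩ := hball
  have hbca : jac b c a ≠ 0 := by rwa [jac_rotate]
  have hacb : jac a c b ≠ 0 := by rw [jac_swap]; exact neg_ne_zero.2 hjac
  have jbca : |jac b c a| = |jac a b c| := by rw [jac_rotate]
  have jacb : |jac a c b| = |jac a b c| := by rw [jac_swap, abs_neg]
  have pbca : ({b, c, a} : Finset Plane) = {a, b, c} := by
    rw [Finset.pair_comm c a, Finset.insert_comm]
  have pacb : ({a, c, b} : Finset Plane) = {a, b, c} := by rw [Finset.pair_comm]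
  have hρ : 0 ≤ δ * Metric.diam (hull K) := (mul_pos hδ hd).le
  refine H a b c (Metric.diam (hull K)) hjac hd ⟨?_, ?_⟩ ⟨?_, ?_⟩ ⟨?_, ?_⟩ ψ (polyLaplacian p)
    ga gb gc hψ.1 (totalDegree_polyLaplacian_le hpdeg) ?_ ?_ ?_ ?_
  · rw [mul_assoc 2 δ]
    exact le_abs_jac_of_closedBall_subset hρ hjac (hx₀.trans (by rw [hK]))
  · exact abs_jac_le (hdist a ma c mc)
  · rw [mul_assoc 2 δ, ← jbca]
    exact le_abs_jac_of_closedBall_subset hρ hbca (hx₀.trans (by rw [pbca, hK]))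
  · rw [← jbca]
    exact abs_jac_le (hdist b mb a ma)
  · rw [mul_assoc 2 δ, ← jacb]
    exact le_abs_jac_of_closedBall_subset hρ hacb (hx₀.trans (by rw [pacb, hK]))
  · rw [← jacb]
    exact abs_jac_le (hdist a ma b mb)
  · exact totalDegree_C_mul_le (totalDegree_sub_le' hqa (totalDegree_dirDeriv_le _ hpdeg)) _
  · exact totalDegree_C_mul_le (totalDegree_sub_le' hqb (totalDegree_dirDeriv_le _ hpdeg)) _
  · exact totalDegree_C_mul_le (totalDegree_sub_le' hqc (totalDegree_dirDeriv_le _ hpdeg)) _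
  intro φ hφ
  have e1 := hψ.2 φ hφ
  have e2 : (∫ x in hull K, polyFun ψ x * polyFun φ x) = triInt {a, b, c} (ψ * φ) := by
    simp only [triInt_apply, polyFun_mul, ← hK]
  have e3 : (∫ x in hull K, ⟪gradientWithin v.1 (hull K) x, ∇ (polyFun φ) x⟫) =
      triInt {a, b, c} (gradInner p φ) := by
    rw [← hK, triInt_apply]
    refine setIntegral_congr_fun (isCompact_hull K).measurableSet fun x hx => ?_
    simp only [hgrad hx, polyFun_gradInner]
  have e4 : boundaryIntegral K (fun z x =>
        v.2 (K.erase z) x * ⟪ne (K.erase z), outwardNormal K z⟫ * polyFun φ x) =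
      edgeInt b c (MvPolynomial.C σa * qa * φ) + edgeInt a c (MvPolynomial.C σb * qb * φ) +
        edgeInt a b (MvPolynomial.C σc * qc * φ) := by
    refine boundaryIntegral_triangle hab hac hbc hK ea eb ec (fun x hx => ?_) (fun x hx => ?_)
      (fun x hx => ?_)
    · have e := eqa hx
      rw [← ea] at e
      simp only [polyFun_mul, polyFun_C, e]
      rw [mul_comm (polyFun qa x)]
    · have e := eqb hx
      rw [← eb] at e
      simp only [polyFun_mul, polyFun_C, e]
      rw [mul_comm (polyFun qb x)]
    · have e := eqc hx
      rw [← ec] at e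
      simp only [polyFun_mul, polyFun_C, e]
      rw [mul_comm (polyFun qc x)]
  have e5 := green_triangle hjac una unb unc oa ob oc pa pb pc p φ
  -- Outward normals are replaced by `σ n_e`, so that Green's formula and the boundary term in the
  -- equation for `ψ` use the same derivative.
  rw [da, db, dc, dirDeriv_smul, dirDeriv_smul, dirDeriv_smul] at e5
  rw [e2, e3, e4] at e1
  simp only [hga, hgb, hgc, mul_sub, sub_mul, map_sub]
  linarith

/-! ### The global estimate -/

theorem Triangulation.diam_le_meshSize {Ω : Set Plane} (T : Triangulation Ω) {K : Finset Plane}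
    (hK : K ∈ T.elements) : Metric.diam (hull K) ≤ T.meshSize :=
  le_csSup ((T.elements.finite_toSet.image _).bddAbove) ⟨K, hK, rfl⟩

theorem Triangulation.mem_elements {Ω : Set Plane} (T : Triangulation Ω) {K : Finset Plane} :
    K ∈ T.elements ↔ K ∈ T.faces ∧ K.card = 3 := by
  simp [Triangulation.elements]

theorem Triangulation.erase_mem_edges {Ω : Set Plane} (T : Triangulation Ω) {K : Finset Plane}
    (hK : K ∈ T.elements) {z : Plane} (hz : z ∈ K) : K.erase z ∈ T.edges := by
  obtain ⟨hf, hc⟩ := T.mem_elements.1 hK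
  have hcard : (K.erase z).card = 2 := by rw [Finset.card_erase_of_mem hz, hc]
  simp only [Triangulation.edges, Finset.mem_filter, Set.Finite.mem_toFinset]
  exact ⟨T.down_closed hf (Finset.erase_subset _ _) (Finset.card_pos.1 (by omega)), hcard⟩

theorem lemma3p2 (Ω : Set Plane) (hΩ : IsPolygonalDomain Ω) (k : ℕ) (δ : ℝ) (hδ : 0 < δ) :
    ∃ C₁ C₂ : ℝ, 0 < C₁ ∧ 0 < C₂ ∧
      ∀ T : Triangulation Ω, T.IsQuasiUniform δ →
      ∀ ne : Finset Plane → Plane, T.IsNormalChoice ne →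
      ∀ v ∈ T.WGSpace k,
        C₁ * norm2h T ne v ≤ tripleNorm T ne k v ∧
        tripleNorm T ne k v ≤ C₂ * norm2h T ne v := by
  obtain ⟨C, hC, H⟩ := exists_element_bounds k hδ
  have hs : 0 < Real.sqrt C := Real.sqrt_pos.2 hC
  -- The constant `C` compares the squared norms element by element, hence its square root compares
  -- the norms.
  refine ⟨(Real.sqrt C)⁻¹, Real.sqrt C, inv_pos.2 hs, hs, fun T hT ne hne v hv => ?_⟩
  have key := fun K (hK : K ∈ T.elements) => H K ne v (T.indep (T.mem_elements.1 hK).1)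
    (T.mem_elements.1 hK).2
    (by
      -- As `h_K ≤ h`, the disc of radius `δ h` contains the concentric one of radius `δ h_K`.
      obtain ⟨x, hx⟩ := hT K hK
      exact ⟨x, (Metric.closedBall_subset_closedBall
        (mul_le_mul_of_nonneg_left (T.diam_le_meshSize hK) hδ.le)).trans hx⟩)
    (fun z hz => hne _ (T.erase_mem_edges hK hz)) (hv.2.1 K hK)
    (fun z hz => hv.2.2 _ (T.erase_mem_edges hK hz))
  constructor
  · rw [inv_mul_le_iff₀ hs, norm2h, tripleNorm, ← Real.sqrt_mul hC.le, Finset.mul_sum]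
    exact Real.sqrt_le_sqrt (Finset.sum_le_sum fun K hK => (key K hK).2)
  · rw [norm2h, tripleNorm, ← Real.sqrt_mul hC.le, Finset.mul_sum]
    exact Real.sqrt_le_sqrt (Finset.sum_le_sum fun K hK => (key K hK).1)
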